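/- **Setting.** Let $f(x)=\int_\Xi F(x,\xi)\,dP(\xi)$, $x\in\mathbb R^n$, be bounded from below with $f^*=\inf f$, where $P$ is a probability measure on a standard Borel space $\Xi$, $F$ is Borel, $F(x,\cdot)$ is $P$-integrable for every $x$, and $F(\cdot,\xi)$ is $P$-almost surely differentiable with $L$-Lipschitz gradient ($L>0$). Given $x_1\in\mathbb R^n$, $N\ge 1$, stepsizes $\gamma_k>0$ and a smoothing parameter $\mu>0$, the randomized stochastic gradient free (RSGF) method generates $$x_{k+1}=x_k-\gamma_k G_\mu(x_k,\xi_k,u_k),\qquad G_\mu(x,\xi,u)=\frac{F(x+\mu u,\xi)-F(x,\xi)}{\mu}\,u ,\qquad k\ge 1,$$ and outputs $x_R$, where $\mathbb P(R=k)=\dfrac{\gamma_k-2L(n+4)\gamma_k^2}{\sum_{j=1}^N[\gamma_j-2L(n+4)\gamma_j^2]}$, $k=1,\dots,N$. Here $u_k$ is a standard Gaussian vector in $\mathbb R^n$ independent of $\xi_k$ and of the history $\zeta_{[k-1]}=(\xi_i,u_i)_{i<k}$, and $R$ is independent of $\zeta_{[N]}$. The $\xi_k$ need not be independent; $F(\cdot,\xi_k)$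 is almost surely differentiable with $L$-Lipschitz gradient, and for every $k\ge1$ and every $x$, with $\sigma\ge 0$, $F(x,\xi_k)$, $\nabla_xF(x,\xi_k)$ and $\|\nabla_xF(x,\xi_k)-\nabla f(x)\|^2$ are integrable and $$\mathbb E[F(x,\xi_k)\mid\zeta_{[k-1]}]=f(x),\quad \mathbb E[\nabla_xF(x,\xi_k)\mid\zeta_{[k-1]}]=\nabla f(x),\quad \mathbb E\big[\|\nabla_xF(x,\xi_k)-\nabla f(x)\|^2\mid\zeta_{[k-1]}\big]\le\sigma^2 .$$ Put $D_f=[2(f(x_1)-f^*)/L]^{1/2}$. **Statement.** Let $\tilde D>0$, $$\gamma_k=\frac1{\sqrt{n+4}}\min\Big\{\frac1{4L\sqrt{n+4}},\frac{\tilde D}{\sigma\sqrt N}\Big\}\quad(k=1,\dots,N),\qquad 0<\mu\le\frac{D_f}{(n+4)\sqrt{2N}}$$ (the second entry of the minimum being $+\infty$ when $\sigma=0$). Then, with expectations over $R$ and $\zeta_{[N]}$: (a) $\|\nabla f(x_R)\|^2$ is integrable and $$\frac1L\,\mathbb E\|\nabla f(x_R)\|^2\le\frac{12(n+4)LD_f^2}{N}+\frac{4\sigma\sqrt{n+4}}{\sqrt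 N}\Big(\tilde D+\frac{D_f^2}{\tilde D}\Big).$$ (b) If, in addition, $f$ is convex with a minimizer $x^*$ and $\mu\le D_X/\sqrt{n+4}$, where $D_X=\|x_1-x^*\|$, then $f(x_R)-f^*$ is integrable and $$\mathbb E[f(x_R)-f^*]\le\frac{5L(n+4)D_X^2}{N}+\frac{2\sigma\sqrt{n+4}}{\sqrt N}\Big(\tilde D+\frac{D_X^2}{\tilde D}\Big).$$ (c) Consequently the iteration complexity is $O(n/\varepsilon^2)$: for every $D$ there is a constant $C>0$, depending only on $L,\sigma,\tilde D,D$, such that for all $n\ge1$, $\varepsilon\in(0,1]$ and $N\ge Cn/\varepsilon^2$, every run as above satisfies $\mathbb E\|\nabla f(x_R)\|^2\le\varepsilon$ if $D_f\le D$, and, under the additional hypotheses of (b), $\mathbb E[f(x_R)-f^*]\le\varepsilon$ if $D_X\le D$. -/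

import Mathlib

open MeasureTheory ProbabilityTheory Finset

universe u v

noncomputable section

/-- The Euclidean space `ℝⁿ`. -/
abbrev E (n : ℕ) : Type := EuclideanSpace ℝ (Fin n)

/-- The class `C^{1,1}_L(ℝⁿ)`: differentiable functions whose gradient is `L`-Lipschitz. -/
def IsC11 {n : ℕ} (L : ℝ) (f : E n → ℝ) : Prop :=
  Differentiable ℝ f ∧ ∀ x y : E n, ‖gradient f y - gradient f x‖ ≤ L * ‖y - x‖

/-- The objective `f(x) = ∫ F(x, ξ) dP(ξ)`. -/
def objective {n : ℕ} {Ξ : Type v} [MeasurableSpace Ξ] (P : Measure Ξ) (F : E n → Ξ → ℝ)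
    (x : E n) : ℝ :=
  ∫ s, F x s ∂P

/-- The optimal value `f* = inf_x f(x)` (used for `f` bounded from below). -/
def optValue {n : ℕ} (f : E n → ℝ) : ℝ := ⨅ x, f x

/-- The stochastic gradient `G(x, ξ)`: the gradient of `F(·, ξ)` at `x`. -/
def stochGrad {n : ℕ} {Ξ : Type v} (F : E n → Ξ → ℝ) (x : E n) (s : Ξ) : E n :=
  gradient (fun y => F y s) x

/-- The gradient-free estimator `G_μ(x, ξ, u) = ((F(x + μ u, ξ) - F(x, ξ)) / μ) u`. -/
def gradFree {n : ℕ} {Ξ : Type v} (F : E n → Ξ → ℝ) (μ : ℝ) (x : E n) (s : Ξ) (w : E n) : E n :=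
  ((F (x + μ • w) s - F x s) / μ) • w

/-- The search points of the randomized stochastic gradient free method, numbered from `1`:
`x_1 = x₁` and `x_{k+1} = x_k - γ_k G_μ(x_k, ξ_k, u_k)` for `k ≥ 1`.
(The value at the index `0` is a placeholder that is never used.) -/
def rsgfIterate {n : ℕ} {Ω : Type u} {Ξ : Type v} (F : E n → Ξ → ℝ) (γ : ℕ → ℝ) (μ : ℝ)
    (x₁ : E n) (ξ : ℕ → Ω → Ξ) (w : ℕ → Ω → E n) : ℕ → Ω → E n
  | 0, _ => x₁
  | 1, _ => x₁
  | k + 2, ω =>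
      rsgfIterate F γ μ x₁ ξ w (k + 1) ω
        - γ (k + 1) • gradFree F μ (rsgfIterate F γ μ x₁ ξ w (k + 1) ω)
            (ξ (k + 1) ω) (w (k + 1) ω)

/-- The output `x_R` of the method. -/
def rsgfOutput {n : ℕ} {Ω : Type u} {Ξ : Type v} (F : E n → Ξ → ℝ) (γ : ℕ → ℝ) (μ : ℝ)
    (x₁ : E n) (ξ : ℕ → Ω → Ξ) (w : ℕ → Ω → E n) (R : Ω → ℕ) (ω : Ω) : E n :=
  rsgfIterate F γ μ x₁ ξ w (R ω) ω

/-- The probability mass function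
`P_R(k) = (γ_k - 2L(n+4)γ_k²) / ∑_{j=1}^N (γ_j - 2L(n+4)γ_j²)`. -/
def rsgfPmf (n : ℕ) (L : ℝ) (γ : ℕ → ℝ) (N k : ℕ) : ℝ :=
  (γ k - 2 * L * (n + 4) * γ k ^ 2) / ∑ j ∈ Icc 1 N, (γ j - 2 * L * (n + 4) * γ j ^ 2)

/-- The constant stepsize `(n+4)^{-1/2} min {1 / (4L√(n+4)), D̃ / (σ√N)}`. For `σ = 0` the second
entry of the minimum is `+∞`, so that the minimum is the first entry. -/
def rsgfStep (n : ℕ) (L σ Dt : ℝ) (N : ℕ) : ℝ :=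
  1 / √(n + 4 : ℝ) *
    if σ = 0 then 1 / (4 * L * √(n + 4 : ℝ))
    else min (1 / (4 * L * √(n + 4 : ℝ))) (Dt / (σ * √N))

/-- `D_f = [2 (f(x₁) - f*) / L]^{1/2}`. -/
def distF {n : ℕ} (L : ℝ) (f : E n → ℝ) (x₁ : E n) : ℝ :=
  √(2 * (f x₁ - optValue f) / L)

/-- The history `ζ_{[k-1]} = ((ξ_1, u_1), …, (ξ_{k-1}, u_{k-1}))`. -/
def history {n : ℕ} {Ω : Type u} {Ξ : Type v} (ξ : ℕ → Ω → Ξ) (w : ℕ → Ω → E n) (k : ℕ)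
    (ω : Ω) : Ico 1 k → Ξ × E n :=
  fun i => (ξ i ω, w i ω)

/-- The σ-algebra generated by the history `ζ_{[k-1]}`. -/
abbrev historySigma {n : ℕ} {Ω : Type u} {Ξ : Type v} [MeasurableSpace Ξ]
    (ξ : ℕ → Ω → Ξ) (w : ℕ → Ω → E n) (k : ℕ) : MeasurableSpace Ω :=
  MeasurableSpace.comap (history ξ w k) inferInstance

/-- The stochastic program `f* = inf_x { f(x) = ∫ F(x, ξ) dP(ξ) }`: `F` is a Borel function, the
integral exists, `F(·, ξ)` is almost surely in `C^{1,1}_L`, and `f` is bounded from below. -/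
structure IsStochasticProgram {n : ℕ} {Ξ : Type v} [MeasurableSpace Ξ] (P : Measure Ξ)
    (F : E n → Ξ → ℝ) (L : ℝ) : Prop where
  measurable : Measurable (Function.uncurry F)
  integrable : ∀ x, Integrable (F x) P
  smooth : ∀ᵐ s ∂P, IsC11 L (fun x => F x s)
  bddBelow : BddBelow (Set.range (objective P F))

/-- Assumption A1, for the query points of an oracle that is called after the history `ζ_{[k-1]}`:
the stochastic gradient is conditionally unbiased, with conditional variance at most `σ²`.
The variables `ξ_k` need not be independent. -/
structure AssumptionA1 {n : ℕ} {Ω : Type u} {Ξ : Type v} [MeasurableSpace Ω] [MeasurableSpace Ξ]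
    (Pr : Measure Ω) (P : Measure Ξ) (F : E n → Ξ → ℝ) (ξ : ℕ → Ω → Ξ) (w : ℕ → Ω → E n)
    (σ : ℝ) : Prop where
  integrable : ∀ k, 1 ≤ k → ∀ x, Integrable (fun ω => stochGrad F x (ξ k ω)) Pr
  unbiased : ∀ k, 1 ≤ k → ∀ x,
    Pr[fun ω => stochGrad F x (ξ k ω) | historySigma ξ w k]
      =ᵐ[Pr] fun _ => gradient (objective P F) x
  sq_integrable : ∀ k, 1 ≤ k → ∀ x,
    Integrable (fun ω => ‖stochGrad F x (ξ k ω) - gradient (objective P F) x‖ ^ 2) Pr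
  variance_le : ∀ k, 1 ≤ k → ∀ x,
    Pr[fun ω => ‖stochGrad F x (ξ k ω) - gradient (objective P F) x‖ ^ 2 | historySigma ξ w k]
      ≤ᵐ[Pr] fun _ => σ ^ 2

/-- Assumption A3: the function values returned by the zeroth-order oracle are conditionally
unbiased. -/
structure AssumptionA3 {n : ℕ} {Ω : Type u} {Ξ : Type v} [MeasurableSpace Ω] [MeasurableSpace Ξ]
    (Pr : Measure Ω) (P : Measure Ξ) (F : E n → Ξ → ℝ) (ξ : ℕ → Ω → Ξ)
    (w : ℕ → Ω → E n) : Prop where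
  integrable : ∀ k, 1 ≤ k → ∀ x, Integrable (fun ω => F x (ξ k ω)) Pr
  unbiased : ∀ k, 1 ≤ k → ∀ x,
    Pr[fun ω => F x (ξ k ω) | historySigma ξ w k] =ᵐ[Pr] fun _ => objective P F x

/-- The randomness of the method with iteration limit `N`: `u_k` is a standard Gaussian vector
generated independently of the history and of `ξ_k`; the random iteration count `R` has the mass
function `P_R` on `{1, …, N}` and is independent of `ζ_{[N]}`; `F(·, ξ_k)` is almost surely in
`C^{1,1}_L`. -/
structure IsRSGFSampling {n : ℕ} {Ω : Type u} {Ξ : Type v} [MeasurableSpace Ω] [MeasurableSpace Ξ]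
    (Pr : Measure Ω) (F : E n → Ξ → ℝ) (ξ : ℕ → Ω → Ξ) (w : ℕ → Ω → E n) (R : Ω → ℕ)
    (L : ℝ) (γ : ℕ → ℝ) (N : ℕ) : Prop where
  measurable_noise : ∀ k, 1 ≤ k → Measurable (ξ k)
  smooth : ∀ k, 1 ≤ k → ∀ᵐ ω ∂Pr, IsC11 L (fun x => F x (ξ k ω))
  measurable_gauss : ∀ k, 1 ≤ k → Measurable (w k)
  gauss : ∀ k, 1 ≤ k → Pr.map (w k) = stdGaussian (E n)
  indep_gauss : ∀ k, 1 ≤ k → IndepFun (w k) (fun ω => (ξ k ω, history ξ w k ω)) Pr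
  measurable_count : Measurable R
  pmf : ∀ k ∈ Icc 1 N, Pr.real {ω | R ω = k} = rsgfPmf n L γ N k
  indep_count : IndepFun R (history ξ w (N + 1)) Pr

/-- A run of the randomized stochastic gradient free method with iteration limit `N`, smoothing
parameter `μ` and constant stepsize, on a stochastic program in `C^{1,1}_L` that satisfies
Assumptions A1 and A3. -/
structure IsRSGFRun {n : ℕ} {Ω : Type u} {Ξ : Type v} [MeasurableSpace Ω] [MeasurableSpace Ξ]
    (Pr : Measure Ω) (P : Measure Ξ) (F : E n → Ξ → ℝ) (ξ : ℕ → Ω → Ξ) (w : ℕ → Ω → E n)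
    (R : Ω → ℕ) (L σ Dt : ℝ) (γ : ℕ → ℝ) (μ : ℝ) (N : ℕ) : Prop where
  program : IsStochasticProgram P F L
  a1 : AssumptionA1 Pr P F ξ w σ
  a3 : AssumptionA3 Pr P F ξ w
  sampling : IsRSGFSampling Pr F ξ w R L γ N
  step : ∀ k ∈ Icc 1 N, γ k = rsgfStep n L σ Dt N
  mu_pos : 0 < μ

end

/-! Part (a) sums the descent inequality `f(x_{k+1}) ≤ f(x_k) - γ⟨∇f(x_k), G⟩ + (Lγ²/2)‖G‖²` in
expectation, part (b) the expansion of `‖x_{k+1} - x*‖²`. Both need a lower bound for the mean of an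
inner product with `G` and an upper bound for `E‖G‖²`. By Taylor's formula the difference quotient
of a `C^{1,1}` function in direction `u` is `⟨∇, u⟩` up to `(μL/2)‖u‖²`, which leads to Gaussian
moments. The decisive one is `E[⟨a, u⟩²‖u‖²] = (n+2)‖a‖²`: through it the factor of the squared
gradient in `E‖G‖²` is only linear in `n`, whence the rate `n/ε²`. The higher moments, and the
identity `E[q(u)u] = E∇f(x+μu)` behind (b), come from integration by parts,
`integral_mul_inner_stdGaussian`.

The oracle is unbiased, given the history, at deterministic points only, whereas `x_k` is random and
the `ξ_k` may be dependent. But `F(·, ξ_k) - f` has a `2L`-Lipschitz gradient, so the error fields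
are Lipschitz in the point, and `x_k` can be approximated by simple functions of the history
(`integral_comp_le_of_setIntegral_le`, `integral_inner_comp_eq_zero`). Independence of `u_k` from
`ξ_k` and the history then allows Fubini in either order: for the second moment the direction is
averaged first, with the sample fixed; for the inner product the sample is averaged first, with the
direction fixed, which replaces `F` by `f`.

The one-step inequalities telescope. The stepsize is constant, so `R` is uniform and the expectation
at `x_R` is the average over the steps. The first entry of the minimum keeps the useful coefficient
positive, the second balances noise against the initial distance. -/

open scoped RealInnerProductSpace

/-! ### Functions with Lipschitz gradient -/

namespace IsC11

variable {n : ℕ} {L L' : ℝ} {f g : E n → ℝ}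

theorem hasGradientAt (hf : IsC11 L f) (x : E n) : HasGradientAt f (gradient f x) x :=
  (hf.1 x).hasGradientAt

theorem continuous (hf : IsC11 L f) : Continuous f := hf.1.continuous

theorem hasDerivAt_line (hf : IsC11 L f) (x h : E n) (t : ℝ) :
    HasDerivAt (fun s : ℝ => f (x + s • h)) ⟪gradient f (x + t • h), h⟫ t := by
  have h1 : HasDerivAt (fun s : ℝ => x + s • h) h t := by
    simpa using ((hasDerivAt_id t).smul_const h).const_add x
  have h2 := (hf.hasGradientAt (x + t • h)).hasFDerivAt.comp_hasDerivAt t h1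
  rwa [InnerProductSpace.toDual_apply_apply] at h2

/-- The quadratic bound on the first-order Taylor remainder. -/
theorem abs_sub_sub_inner_le (hf : IsC11 L f) (x h : E n) :
    |f (x + h) - f x - ⟪gradient f x, h⟫| ≤ L / 2 * ‖h‖ ^ 2 := by
  have hd : ∀ t : ℝ, HasDerivAt (fun s : ℝ => f (x + s • h) - f x - s * ⟪gradient f x, h⟫)
      (⟪gradient f (x + t • h), h⟫ - ⟪gradient f x, h⟫) t := fun t => by
    have := ((hf.hasDerivAt_line x h t).sub_const (f x)).sub
      ((hasDerivAt_id t).mul_const ⟪gradient f x, h⟫)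
    rwa [one_mul] at this
  have hB : ∀ t : ℝ, HasDerivAt (fun s : ℝ => L / 2 * ‖h‖ ^ 2 * s ^ 2) (L * ‖h‖ ^ 2 * t) t := by
    intro t
    have := (hasDerivAt_pow 2 t).const_mul (L / 2 * ‖h‖ ^ 2)
    rwa [show L / 2 * ‖h‖ ^ 2 * (((2 : ℕ) : ℝ) * t ^ (2 - 1)) = L * ‖h‖ ^ 2 * t by
      norm_num; ring] at this
  -- The remainder along the segment vanishes at `0` and its derivative at `t` is at most `L‖h‖²t`;
  -- comparison with the primitive `B` gives the bound at `t = 1`.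
  have key := image_norm_le_of_norm_deriv_right_le_deriv_boundary (a := 0) (b := 1)
    (f := fun s : ℝ => f (x + s • h) - f x - s * ⟪gradient f x, h⟫)
    (f' := fun t => ⟪gradient f (x + t • h), h⟫ - ⟪gradient f x, h⟫)
    (B := fun s : ℝ => L / 2 * ‖h‖ ^ 2 * s ^ 2) (B' := fun t => L * ‖h‖ ^ 2 * t)
    (fun t _ => (hd t).continuousAt.continuousWithinAt) (fun t _ => (hd t).hasDerivWithinAt)
    (by simp) hB ?_ (Set.right_mem_Icc.2 zero_le_one)
  · simpa using key
  · intro t ht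
    rw [← inner_sub_left]
    calc ‖⟪gradient f (x + t • h) - gradient f x, h⟫‖
        ≤ ‖gradient f (x + t • h) - gradient f x‖ * ‖h‖ := norm_inner_le_norm _ _
      _ ≤ (L * ‖x + t • h - x‖) * ‖h‖ := by gcongr; exact hf.2 _ _
      _ = L * ‖h‖ ^ 2 * t := by
        rw [add_sub_cancel_left, norm_smul, Real.norm_of_nonneg ht.1]; ring

theorem gradient_sub (hf : IsC11 L f) (hg : IsC11 L' g) (x : E n) :
    gradient (fun x => f x - g x) x = gradient f x - gradient g x := by
  refine HasGradientAt.gradient ?_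
  rw [hasGradientAt_iff_hasFDerivAt, map_sub]
  exact (hf.hasGradientAt x).hasFDerivAt.sub (hg.hasGradientAt x).hasFDerivAt

/-- Meant for the sampling error `F(·, ξ) - f`, to which all bounds for `C^{1,1}` functions then
apply with constant `2L`. -/
theorem sub (hf : IsC11 L f) (hg : IsC11 L' g) : IsC11 (L + L') (fun x => f x - g x) := by
  refine ⟨hf.1.sub hg.1, fun x y => ?_⟩
  rw [hf.gradient_sub hg, hf.gradient_sub hg]
  calc ‖gradient f y - gradient g y - (gradient f x - gradient g x)‖
      = ‖(gradient f y - gradient f x) - (gradient g y - gradient g x)‖ := by congr 1; abel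
    _ ≤ ‖gradient f y - gradient f x‖ + ‖gradient g y - gradient g x‖ := norm_sub_le _ _
    _ ≤ L * ‖y - x‖ + L' * ‖y - x‖ := add_le_add (hf.2 _ _) (hg.2 _ _)
    _ = _ := by ring

/-- Increments along a fixed direction are Lipschitz in the base point. -/
theorem abs_increment_sub_le (hf : IsC11 L f) (h a b : E n) :
    |(f (a + h) - f a) - (f (b + h) - f b)| ≤ L * ‖h‖ * ‖a - b‖ := by
  have hd : ∀ z ∈ (Set.univ : Set (E n)), HasFDerivWithinAt (fun z => f (z + h) - f z)
      (InnerProductSpace.toDual ℝ (E n) (gradient f (z + h) - gradient f z)) Set.univ z := by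
    intro z _
    rw [map_sub]
    refine HasFDerivAt.hasFDerivWithinAt ?_
    exact ((hasFDerivAt_comp_add_right h).2 (hf.hasGradientAt (z + h)).hasFDerivAt).sub
      (hf.hasGradientAt z).hasFDerivAt
  have := convex_univ.norm_image_sub_le_of_norm_hasFDerivWithin_le (C := L * ‖h‖) hd
    (fun z _ => by
      rw [LinearIsometryEquiv.norm_map]
      simpa using hf.2 z (z + h)) (Set.mem_univ b) (Set.mem_univ a)
  simpa using this

/-- A gradient step of length `1/L` lowers `f` by at least `‖∇f(x)‖²/(2L)`, and the result is still
at least `c`. -/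
theorem sq_norm_gradient_le (hL : 0 < L) (hf : IsC11 L f) {c : ℝ} (hc : ∀ x, c ≤ f x) (x : E n) :
    ‖gradient f x‖ ^ 2 ≤ 2 * L * (f x - c) := by
  have h1 := (abs_le.1 (hf.abs_sub_sub_inner_le x (-(1 / L) • gradient f x))).2
  have h2 := hc (x + -(1 / L) • gradient f x)
  rw [real_inner_smul_right, real_inner_self_eq_norm_sq, norm_smul, mul_pow] at h1
  have h3 : ‖-(1 / L)‖ ^ 2 = (1 / L) ^ 2 := by rw [Real.norm_eq_abs, sq_abs]; ring
  rw [h3] at h1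
  have h4 : L / 2 * ((1 / L) ^ 2 * ‖gradient f x‖ ^ 2) = ‖gradient f x‖ ^ 2 / (2 * L) := by
    field_simp
  have h5 : -(1 / L) * ‖gradient f x‖ ^ 2 = - 2 * (‖gradient f x‖ ^ 2 / (2 * L)) := by
    field_simp
  rw [h4, h5] at h1
  have h6 : ‖gradient f x‖ ^ 2 / (2 * L) ≤ f x - c := by linarith
  rw [div_le_iff₀ (by positivity)] at h6
  linarith

theorem norm_gradient_le (hf : IsC11 L f) (x : E n) :
    ‖gradient f x‖ ≤ ‖gradient f 0‖ + L * ‖x‖ := by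
  have h1 := hf.2 0 x
  have h2 := norm_le_norm_add_norm_sub (gradient f 0) (gradient f x)
  rw [sub_zero] at h1
  rw [norm_sub_rev] at h2
  linarith

theorem abs_apply_le (hf : IsC11 L f) (x : E n) :
    |f x| ≤ |f 0| + ‖gradient f 0‖ * ‖x‖ + L / 2 * ‖x‖ ^ 2 := by
  have h1 := hf.abs_sub_sub_inner_le 0 x
  have h2 := abs_real_inner_le_norm (gradient f 0) x
  rw [zero_add] at h1
  rw [abs_le] at *
  have h3 := neg_abs_le (f 0)
  have h4 := le_abs_self (f 0)
  constructor <;> linarith [h1.1, h1.2, h2.1, h2.2]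

theorem continuous_gradient (hf : IsC11 L f) : Continuous (gradient f) := by
  refine LipschitzWith.continuous (K := L.toNNReal) (LipschitzWith.of_dist_le_mul fun x y => ?_)
  rw [dist_eq_norm, dist_eq_norm]
  exact (hf.2 y x).trans (by gcongr; exact Real.le_coe_toNNReal L)

theorem inner_le_of_convexOn (hf : IsC11 L f) (hc : ConvexOn ℝ Set.univ f) (x y : E n) :
    f x + ⟪gradient f x, y - x⟫ ≤ f y := by
  have hline : ConvexOn ℝ Set.univ (fun t : ℝ => f (x + t • (y - x))) := by
    have := hc.comp_affineMap (AffineMap.lineMap x y : ℝ →ᵃ[ℝ] E n)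
    refine this.congr fun t _ => ?_
    simp [AffineMap.lineMap_apply, add_comm]
  have hd := hf.hasDerivAt_line x (y - x) 0
  have := hline.le_slope_of_hasDerivAt (Set.mem_univ 0) (Set.mem_univ 1) zero_lt_one hd
  rw [zero_smul, add_zero, slope_def_field] at this
  norm_num at this
  rw [inner_gradient_left]
  simp only [map_sub]
  linarith

theorem gradient_eq_zero_of_isMinOn {x : E n} (h : IsMinOn f Set.univ x) : gradient f x = 0 := by
  have h1 : IsLocalMin f x := (isMinOn_univ_iff.1 h |> fun h' => Filter.Eventually.of_forall h')
  rw [gradient, h1.fderiv_eq_zero, map_zero]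

/-- A function with a quadratic Taylor remainder and a Lipschitz linear part is `C^{1,1}`. -/
theorem of_abs_sub_sub_inner_le {G : E n → E n} {C : ℝ}
    (h : ∀ x y, |f (x + y) - f x - ⟪G x, y⟫| ≤ C * ‖y‖ ^ 2)
    (hG : ∀ x y, ‖G y - G x‖ ≤ L * ‖y - x‖) : IsC11 L f ∧ gradient f = G := by
  have hg : ∀ x, HasGradientAt f (G x) x := by
    intro x
    rw [hasGradientAt_iff_isLittleO_nhds_zero]
    have h1 : (fun y => f (x + y) - f x - ⟪G x, y⟫) =O[nhds 0] fun y : E n => ‖y‖ ^ 2 := by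
      refine Asymptotics.IsBigO.of_bound C (Filter.Eventually.of_forall fun y => ?_)
      simpa using h x y
    refine h1.trans_isLittleO ?_
    exact Asymptotics.isLittleO_norm_pow_id one_lt_two
  have he : gradient f = G := gradient_eq hg
  exact ⟨⟨fun x => (hg x).differentiableAt, by rw [he]; exact hG⟩, he⟩

end IsC11

/-! ### Averages of random smooth functions -/

section Family

variable {n : ℕ} {L : ℝ} {α : Type*} [MeasurableSpace α] {ν : Measure α} {Φ : E n → α → ℝ}

theorem integrable_of_forall_integrable_inner {g : α → E n}
    (h : ∀ v : E n, Integrable (fun s => ⟪v, g s⟫) ν) : Integrable g ν := by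
  have h1 : Integrable (fun s => ∑ i, ⟪EuclideanSpace.basisFun (Fin n) ℝ i, g s⟫ •
      EuclideanSpace.basisFun (Fin n) ℝ i) ν :=
    integrable_finsetSum _ fun i _ => (h _).smul_const _
  refine h1.congr (Filter.Eventually.of_forall fun s => ?_)
  exact (EuclideanSpace.basisFun (Fin n) ℝ).sum_repr' (g s)

/-- The gradients of an almost surely `C^{1,1}` family of integrable functions are integrable. -/
theorem integrable_stochGrad [IsFiniteMeasure ν] (hi : ∀ x, Integrable (Φ x) ν)
    (hs : ∀ᵐ s ∂ν, IsC11 L (fun x => Φ x s)) (x : E n) : Integrable (stochGrad Φ x) ν := by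
  refine integrable_of_forall_integrable_inner fun v => ?_
  have hlim : ∀ᵐ s ∂ν, Filter.Tendsto
      (fun m : ℕ => ((m : ℝ) + 1) * (Φ (x + (1 / ((m : ℝ) + 1)) • v) s - Φ x s)) Filter.atTop
      (nhds ⟪v, stochGrad Φ x s⟫) := by
    filter_upwards [hs] with s h
    have h1 := (h.hasDerivAt_line x v 0).tendsto_slope_zero_right
    have h2 := h1.comp (tendsto_nhdsWithin_iff.2 ⟨tendsto_one_div_add_atTop_nhds_zero_nat (𝕜 := ℝ),
      Filter.Eventually.of_forall fun m => by
        simp only [Set.mem_Ioi]; positivity⟩)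
    rw [zero_smul, add_zero, real_inner_comm] at h2
    refine h2.congr fun m => ?_
    simp
  have hm : AEStronglyMeasurable (fun s => ⟪v, stochGrad Φ x s⟫) ν :=
    aestronglyMeasurable_of_tendsto_ae Filter.atTop
      (fun m => (((hi _).sub (hi x)).const_mul _).aestronglyMeasurable) hlim
  -- The Taylor bound with the full increment `v` dominates the directional derivative by integrable
  -- function values and a constant.
  refine Integrable.mono' (((hi (x + v)).sub (hi x)).abs.add
    (integrable_const (L / 2 * ‖v‖ ^ 2))) hm ?_
  filter_upwards [hs] with s h
  have h1 := abs_le.1 (h.abs_sub_sub_inner_le x v)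
  rw [real_inner_comm, Real.norm_eq_abs, abs_le]
  simp only [Pi.add_apply, Pi.sub_apply]
  have h2 := le_abs_self (Φ (x + v) s - Φ x s)
  have h3 := neg_abs_le (Φ (x + v) s - Φ x s)
  rw [stochGrad]
  constructor <;> linarith

/-- The Taylor bound and the Lipschitz bound for `F(·, s)` have constants independent of `s`, so
they survive integration; together they characterize `C^{1,1}_L` with gradient `∫ ∇F(x, s) dP(s)`,
without differentiation under the integral. -/
theorem IsStochasticProgram.isC11_objective {Ξ : Type v} [MeasurableSpace Ξ] {P : Measure Ξ}
    [IsProbabilityMeasure P] {F : E n → Ξ → ℝ} (h : IsStochasticProgram P F L) :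
    IsC11 L (objective P F) := by
  have hg := integrable_stochGrad h.integrable h.smooth
  refine (IsC11.of_abs_sub_sub_inner_le (G := fun x => ∫ s, stochGrad F x s ∂P) (C := L / 2)
    (fun x y => ?_) fun x y => ?_).1
  · rw [objective, objective, real_inner_comm, ← integral_inner (hg x), ← integral_sub
      (h.integrable _) (h.integrable _), ← integral_sub
      (f := fun s => F (x + y) s - F x s) ((h.integrable _).sub (h.integrable _))
      ((hg x).const_inner y)]
    have := norm_integral_le_of_norm_le_const (μ := P) (C := L / 2 * ‖y‖ ^ 2)
      (f := fun s => F (x + y) s - F x s - ⟪y, stochGrad F x s⟫) (by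
        filter_upwards [h.smooth] with s hs
        rw [real_inner_comm]
        exact hs.abs_sub_sub_inner_le x y)
    simpa using this
  · rw [← integral_sub (hg y) (hg x)]
    have := norm_integral_le_of_norm_le_const (μ := P) (C := L * ‖y - x‖)
      (f := fun s => stochGrad F y s - stochGrad F x s) (by
        filter_upwards [h.smooth] with s hs using hs.2 x y)
    simpa using this

end Family

/-! ### Gaussian integration by parts and moments -/

section Gaussian

variable {n : ℕ}

theorem integrable_one_add_norm_pow_stdGaussian (p : ℕ) :
    Integrable (fun u : E n => (1 + ‖u‖) ^ p) (stdGaussian (E n)) := by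
  have h0 : MemLp (fun u : E n => ‖u‖) p (stdGaussian (E n)) :=
    (IsGaussian.memLp_id (stdGaussian (E n)) p (ENNReal.natCast_ne_top p)).norm
  have h1 : MemLp (fun u : E n => 1 + ‖u‖) p (stdGaussian (E n)) :=
    (memLp_const (1 : ℝ)).add h0
  refine h1.integrable_norm_pow'.congr (Filter.Eventually.of_forall fun u => ?_)
  simp only
  rw [Real.norm_of_nonneg (by positivity)]

theorem integrable_stdGaussian_of_le {g : E n → ℝ} {C : ℝ} {p : ℕ}
    (hg : AEStronglyMeasurable g (stdGaussian (E n))) (h : ∀ u, |g u| ≤ C * (1 + ‖u‖) ^ p) :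
    Integrable g (stdGaussian (E n)) :=
  ((integrable_one_add_norm_pow_stdGaussian p).const_mul C).mono' hg (Filter.Eventually.of_forall h)

theorem integral_inner_mul_inner_stdGaussian (a b : E n) :
    ∫ u, ⟪a, u⟫ * ⟪b, u⟫ ∂stdGaussian (E n) = ⟪a, b⟫ := by
  have h1 := covarianceBilin_apply (μ := stdGaussian (E n))
    (IsGaussian.memLp_id _ 2 (by simp)) a b
  rw [covarianceBilin_stdGaussian] at h1
  simp only [id] at h1
  rw [integral_id_stdGaussian, innerSL_apply_apply] at h1
  simpa only [sub_zero] using h1.symm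

theorem integral_inner_stdGaussian (a : E n) : ∫ u, ⟪a, u⟫ ∂stdGaussian (E n) = 0 :=
  integral_strongDual_stdGaussian (innerSL ℝ a)

/-- Gaussian integration by parts, for functions of polynomial growth: the product of two standard
Gaussian measures is invariant under rotations, and the claim is the derivative of this at `0`. -/
theorem integral_mul_inner_stdGaussian {f : E n → ℝ} {f' : E n → StrongDual ℝ (E n)}
    (hf : ∀ x, HasFDerivAt f (f' x) x) {C : ℝ} {p : ℕ} (hb : ∀ x, |f x| ≤ C * (1 + ‖x‖) ^ p)
    (hb' : ∀ x, ‖f' x‖ ≤ C * (1 + ‖x‖) ^ p) (v : E n) :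
    ∫ u, f u * ⟪v, u⟫ ∂stdGaussian (E n) = ∫ u, f' u v ∂stdGaussian (E n) := by
  set γ := stdGaussian (E n)
  have hC : 0 ≤ C := by simpa using (abs_nonneg _).trans (hb 0)
  have hcont : Continuous f := continuous_iff_continuousAt.2 fun x => (hf x).continuousAt
  have hf'm : Measurable f' := by
    rw [← funext fun x => (hf x).fderiv]; exact measurable_fderiv ℝ f
  -- A bound uniform in the angle: rotated points have norm at most `‖z.1‖ + ‖z.2‖`, and `1 + a + b
  -- ≤ (1 + a)(1 + b)` splits it into a product, integrable for the product measure. The two extra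
  -- powers pay for the linear factors in `F'`.
  let bound : E n × E n → ℝ := fun z => 2 * C * ‖v‖ * ((1 + ‖z.1‖) ^ (p + 2) * (1 + ‖z.2‖) ^ (p + 2))
  have hbound : Integrable bound (γ.prod γ) :=
    ((integrable_one_add_norm_pow_stdGaussian (p + 2)).mul_prod
      (integrable_one_add_norm_pow_stdGaussian (p + 2))).const_mul _
  have key1 : ∀ (z : E n × E n) (c s : ℝ), |c| ≤ 1 → |s| ≤ 1 →
      ‖c • z.1 + s • z.2‖ ≤ ‖z.1‖ + ‖z.2‖ := fun z c s hc hs => by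
    refine (norm_add_le _ _).trans ?_
    rw [norm_smul, norm_smul, Real.norm_eq_abs, Real.norm_eq_abs]
    nlinarith [norm_nonneg z.1, norm_nonneg z.2]
  have key2 : ∀ z : E n × E n, ∀ q ≤ p + 2, (1 + (‖z.1‖ + ‖z.2‖)) ^ q
      ≤ (1 + ‖z.1‖) ^ (p + 2) * (1 + ‖z.2‖) ^ (p + 2) := fun z q hq => by
    have h1 := norm_nonneg z.1
    have h2 := norm_nonneg z.2
    rw [← mul_pow]
    calc (1 + (‖z.1‖ + ‖z.2‖)) ^ q ≤ (1 + (‖z.1‖ + ‖z.2‖)) ^ (p + 2) :=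
          pow_le_pow_right₀ (by linarith) hq
      _ ≤ _ := by gcongr; nlinarith
  -- This is `f(X_θ)⟨v, Y_θ⟩` for the rotated pair `(X_θ, Y_θ)`, whose angular derivative is `(Y_θ,
  -- -X_θ)`. Its mean does not depend on `θ`.
  let F : ℝ → E n × E n → ℝ := fun θ z =>
    f (Real.cos θ • z.1 + Real.sin θ • z.2) * ⟪v, (-Real.sin θ) • z.1 + Real.cos θ • z.2⟫
  let F' : ℝ → E n × E n → ℝ := fun θ z =>
    f' (Real.cos θ • z.1 + Real.sin θ • z.2) ((-Real.sin θ) • z.1 + Real.cos θ • z.2)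
        * ⟪v, (-Real.sin θ) • z.1 + Real.cos θ • z.2⟫
      + f (Real.cos θ • z.1 + Real.sin θ • z.2) * ⟪v, (-Real.cos θ) • z.1 + (-Real.sin θ) • z.2⟫
  have hFle : ∀ θ z, ‖F' θ z‖ ≤ bound z := by
    intro θ z
    have hc := Real.abs_cos_le_one θ
    have hs := Real.abs_sin_le_one θ
    set M := ‖z.1‖ + ‖z.2‖ with hM
    have hM0 : 0 ≤ M := by positivity
    have e1 : ‖Real.cos θ • z.1 + Real.sin θ • z.2‖ ≤ M := key1 z _ _ hc hs
    have e2 : ‖(-Real.sin θ) • z.1 + Real.cos θ • z.2‖ ≤ M := key1 z _ _ (by rwa [abs_neg]) hc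
    have e3 : ‖(-Real.cos θ) • z.1 + (-Real.sin θ) • z.2‖ ≤ M :=
      key1 z _ _ (by rwa [abs_neg]) (by rwa [abs_neg])
    have d1 : |⟪v, (-Real.sin θ) • z.1 + Real.cos θ • z.2⟫| ≤ ‖v‖ * M :=
      (abs_real_inner_le_norm _ _).trans (by gcongr)
    have d2 : |⟪v, (-Real.cos θ) • z.1 + (-Real.sin θ) • z.2⟫| ≤ ‖v‖ * M :=
      (abs_real_inner_le_norm _ _).trans (by gcongr)
    have d3 : |f' (Real.cos θ • z.1 + Real.sin θ • z.2) ((-Real.sin θ) • z.1 + Real.cos θ • z.2)|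
        ≤ C * (1 + M) ^ p * M := by
      refine ((f' _).le_opNorm _).trans ?_
      gcongr
      exact (hb' _).trans (by gcongr)
    have d4 : |f (Real.cos θ • z.1 + Real.sin θ • z.2)| ≤ C * (1 + M) ^ p :=
      (hb _).trans (by gcongr)
    calc ‖F' θ z‖ ≤ C * (1 + M) ^ p * M * (‖v‖ * M) + C * (1 + M) ^ p * (‖v‖ * M) := by
          refine (norm_add_le _ _).trans ?_
          rw [norm_mul, norm_mul]
          simp only [Real.norm_eq_abs]
          gcongr
      _ = C * ‖v‖ * (1 + M) ^ p * (M * M + M) := by ring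
      _ ≤ C * ‖v‖ * (1 + M) ^ p * (2 * (1 + M) ^ 2) := by gcongr; nlinarith
      _ = 2 * C * ‖v‖ * (1 + M) ^ (p + 2) := by ring
      _ ≤ bound z := by
        have := key2 z (p + 2) le_rfl
        simp only [bound]
        gcongr
  have hFm : ∀ θ, AEStronglyMeasurable (F θ) (γ.prod γ) := fun θ =>
    (by fun_prop : Continuous (F θ)).aestronglyMeasurable
  have hF0 : Integrable (F 0) (γ.prod γ) := by
    refine hbound.mono' (hFm 0) (Filter.Eventually.of_forall fun z => ?_)
    have h1 := norm_nonneg z.1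
    have h2 := norm_nonneg z.2
    simp only [F, Real.cos_zero, Real.sin_zero, one_smul, zero_smul, add_zero, neg_zero, zero_add,
      norm_mul, Real.norm_eq_abs]
    calc |f z.1| * |⟪v, z.2⟫| ≤ (C * (1 + ‖z.1‖) ^ p) * (‖v‖ * ‖z.2‖) := by
          gcongr
          exacts [hb _, abs_real_inner_le_norm _ _]
      _ ≤ (C * (1 + (‖z.1‖ + ‖z.2‖)) ^ p) * (‖v‖ * (1 + (‖z.1‖ + ‖z.2‖))) := by
          gcongr <;> linarith
      _ = C * ‖v‖ * (1 + (‖z.1‖ + ‖z.2‖)) ^ (p + 1) := by ring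
      _ ≤ C * ‖v‖ * ((1 + ‖z.1‖) ^ (p + 2) * (1 + ‖z.2‖) ^ (p + 2)) := by
          gcongr
          exact key2 z _ (by omega)
      _ ≤ bound z := by
          have : 0 ≤ C * ‖v‖ * ((1 + ‖z.1‖) ^ (p + 2) * (1 + ‖z.2‖) ^ (p + 2)) := by positivity
          simp only [bound]
          linarith
  have hA : Measurable fun z : E n × E n => f' z.1 z.2 :=
    isBoundedBilinearMap_apply.continuous.measurable.comp
      ((hf'm.comp measurable_fst).prodMk measurable_snd)
  have hF'm : AEStronglyMeasurable (F' 0) (γ.prod γ) := by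
    have h1 : F' 0 = fun z => f' z.1 z.2 * ⟪v, z.2⟫ - f z.1 * ⟪v, z.1⟫ := by
      funext z; simp [F', sub_eq_add_neg]
    rw [h1]
    exact ((hA.mul (by fun_prop)).sub (by fun_prop)).aestronglyMeasurable
  have hdiff : ∀ z θ, HasDerivAt (F · z) (F' θ z) θ := by
    intro z θ
    have c1 : HasDerivAt (fun θ => Real.cos θ • z.1 + Real.sin θ • z.2)
        ((-Real.sin θ) • z.1 + Real.cos θ • z.2) θ :=
      ((Real.hasDerivAt_cos θ).smul_const z.1).add ((Real.hasDerivAt_sin θ).smul_const z.2)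
    have c2 : HasDerivAt (fun θ => (-Real.sin θ) • z.1 + Real.cos θ • z.2)
        ((-Real.cos θ) • z.1 + (-Real.sin θ) • z.2) θ :=
      ((Real.hasDerivAt_sin θ).neg.smul_const z.1).add ((Real.hasDerivAt_cos θ).smul_const z.2)
    have c3 := (hf (Real.cos θ • z.1 + Real.sin θ • z.2)).comp_hasDerivAt θ c1
    have c4 := (innerSL ℝ v).hasFDerivAt.comp_hasDerivAt θ c2
    exact c3.mul c4
  have hconst : ∀ θ, ∫ z, F θ z ∂(γ.prod γ) = ∫ z, f z.1 * ⟪v, z.2⟫ ∂(γ.prod γ) := by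
    intro θ
    have hrot := IsGaussian.map_rotation_eq_self_of_forall_strongDual_eq_zero (μ := γ)
      (fun ℓ => integral_strongDual_stdGaussian ℓ) θ
    conv_rhs => rw [← hrot]
    rw [integral_map (by fun_prop) (Continuous.aestronglyMeasurable (by fun_prop))]
    rfl
  obtain ⟨hI, hD⟩ := hasDerivAt_integral_of_dominated_loc_of_deriv_le (μ := γ.prod γ) (F := F)
    (F' := F') (x₀ := 0) (s := Set.univ) (bound := bound) Filter.univ_mem
    (Filter.Eventually.of_forall hFm) hF0 hF'm
    (Filter.Eventually.of_forall fun z θ _ => hFle θ z) hbound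
    (Filter.Eventually.of_forall fun z θ _ => hdiff z θ)
  rw [funext hconst] at hD
  have hzero := hD.unique (hasDerivAt_const 0 _)
  have hI2 : Integrable (fun z : E n × E n => f z.1 * ⟪v, z.1⟫) (γ.prod γ) := by
    refine Integrable.comp_fst (f := fun u => f u * ⟪v, u⟫) ?_ γ
    refine integrable_stdGaussian_of_le (C := C * ‖v‖) (p := p + 1)
      (by fun_prop : Continuous fun u => f u * ⟪v, u⟫).aestronglyMeasurable fun u => ?_
    have h1 := norm_nonneg u
    rw [abs_mul]
    calc |f u| * |⟪v, u⟫| ≤ (C * (1 + ‖u‖) ^ p) * (‖v‖ * (1 + ‖u‖)) := by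
          gcongr
          exacts [hb u, (abs_real_inner_le_norm _ _).trans (by gcongr; linarith)]
      _ = _ := by ring
  have hF'0 : ∀ z, F' 0 z = f' z.1 z.2 * ⟪v, z.2⟫ - f z.1 * ⟪v, z.1⟫ := fun z => by
    simp [F', sub_eq_add_neg]
  have hI1 : Integrable (fun z : E n × E n => f' z.1 z.2 * ⟪v, z.2⟫) (γ.prod γ) := by
    refine (hI.add hI2).congr (Filter.Eventually.of_forall fun z => ?_)
    simp [hF'0]
  simp only [hF'0] at hzero
  rw [integral_sub hI1 hI2, integral_fun_fst (fun u => f u * ⟪v, u⟫), integral_prod _ hI1] at hzero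
  -- Averaging over the second, independent Gaussian uses the identity covariance, with `f' u`
  -- represented by a vector.
  have hinner : ∀ u, ∫ y, f' u y * ⟪v, y⟫ ∂γ = f' u v := fun u => by
    have h1 := integral_inner_mul_inner_stdGaussian ((InnerProductSpace.toDual ℝ (E n)).symm (f' u)) v
    simpa using h1
  simp only [hinner, probReal_univ, one_smul] at hzero
  linarith

theorem integrable_inner_sq_mul_norm_pow_stdGaussian (a : E n) (k : ℕ) :
    Integrable (fun u => ⟪a, u⟫ ^ 2 * ‖u‖ ^ k) (stdGaussian (E n)) := by
  refine integrable_stdGaussian_of_le (C := ‖a‖ ^ 2) (p := k + 2)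
    (Continuous.aestronglyMeasurable (by fun_prop)) fun u => ?_
  have h1 := norm_nonneg u
  rw [abs_mul, abs_pow, abs_of_nonneg (by positivity : 0 ≤ ‖u‖ ^ k)]
  calc |⟪a, u⟫| ^ 2 * ‖u‖ ^ k ≤ (‖a‖ * ‖u‖) ^ 2 * ‖u‖ ^ k := by
        gcongr; exact abs_real_inner_le_norm _ _
    _ = ‖a‖ ^ 2 * ‖u‖ ^ (k + 2) := by ring
    _ ≤ _ := by gcongr; linarith

theorem integrable_norm_pow_stdGaussian (k : ℕ) :
    Integrable (fun u : E n => ‖u‖ ^ k) (stdGaussian (E n)) := by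
  refine integrable_stdGaussian_of_le (C := 1) (p := k)
    (Continuous.aestronglyMeasurable (by fun_prop)) fun u => ?_
  have h1 := norm_nonneg u
  rw [abs_of_nonneg (by positivity), one_mul]
  gcongr
  linarith

/-- Integration by parts in direction `a` for `⟨a, u⟩‖u‖^{2(k+1)}`. With Parseval's identity over an
orthonormal basis this recursion determines the moments of orders 4 and 6 exactly. -/
theorem integral_inner_sq_mul_norm_pow_succ_stdGaussian (a : E n) (k : ℕ) :
    ∫ u, ⟪a, u⟫ ^ 2 * ‖u‖ ^ (2 * (k + 1)) ∂stdGaussian (E n)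
      = ‖a‖ ^ 2 * ∫ u, ‖u‖ ^ (2 * (k + 1)) ∂stdGaussian (E n)
        + 2 * (k + 1) * ∫ u, ⟪a, u⟫ ^ 2 * ‖u‖ ^ (2 * k) ∂stdGaussian (E n) := by
  -- The power is written through `‖u‖ ^ 2`, which is differentiable also at the origin.
  have hf : ∀ u : E n, HasFDerivAt (fun u : E n => ⟪a, u⟫ * (‖u‖ ^ 2) ^ (k + 1))
      (⟪a, u⟫ • ((((k + 1 : ℕ) : ℝ) * (‖u‖ ^ 2) ^ k) • ((2 : ℝ) • innerSL ℝ u))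
        + ((‖u‖ ^ 2) ^ (k + 1)) • innerSL ℝ a) u := fun u => by
    have h1 := (hasStrictFDerivAt_norm_sq u).hasFDerivAt.pow (k + 1)
    have h2 := (innerSL ℝ a).hasFDerivAt (x := u)
    have h3 := h2.mul h1
    refine h3.congr_fderiv ?_
    ext w
    simp
  have h := integral_mul_inner_stdGaussian hf (C := (2 * (k + 1) + 1) * ‖a‖) (p := 2 * (k + 1) + 1)
    (fun u => ?_) (fun u => ?_) a
  · have e1 : ∀ u : E n, ⟪a, u⟫ * (‖u‖ ^ 2) ^ (k + 1) * ⟪a, u⟫ = ⟪a, u⟫ ^ 2 * ‖u‖ ^ (2 * (k + 1)) :=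
      fun u => by rw [pow_mul]; ring
    have e2 : ∀ u : E n, (⟪a, u⟫ • ((((k + 1 : ℕ) : ℝ) * (‖u‖ ^ 2) ^ k) • ((2 : ℝ) • innerSL ℝ u))
        + ((‖u‖ ^ 2) ^ (k + 1)) • innerSL ℝ a) a
        = ‖a‖ ^ 2 * ‖u‖ ^ (2 * (k + 1)) + 2 * (k + 1) * (⟪a, u⟫ ^ 2 * ‖u‖ ^ (2 * k)) := fun u => by
      simp only [add_apply, smul_apply, innerSL_apply_apply, smul_eq_mul,
        real_inner_self_eq_norm_sq, real_inner_comm a u, pow_mul]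
      push_cast
      ring
    simp only [e1, e2] at h
    rw [h, integral_add ((integrable_norm_pow_stdGaussian _).const_mul _)
      ((integrable_inner_sq_mul_norm_pow_stdGaussian a _).const_mul _), integral_const_mul,
      integral_const_mul]
  · have h1 := norm_nonneg u
    have h2 := norm_nonneg a
    rw [abs_mul, abs_of_nonneg (by positivity : 0 ≤ (‖u‖ ^ 2) ^ (k + 1))]
    calc |⟪a, u⟫| * (‖u‖ ^ 2) ^ (k + 1) ≤ ‖a‖ * ‖u‖ * (‖u‖ ^ 2) ^ (k + 1) := by
          gcongr; exact abs_real_inner_le_norm _ _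
      _ = 1 * ‖a‖ * ‖u‖ ^ (2 * (k + 1) + 1) := by rw [← pow_mul]; ring
      _ ≤ _ := by gcongr <;> linarith [(Nat.cast_nonneg k : (0 : ℝ) ≤ k)]
  · have h1 := norm_nonneg u
    have h2 := norm_nonneg a
    refine (norm_add_le _ _).trans ?_
    rw [norm_smul, norm_smul, norm_smul, norm_smul, innerSL_apply_norm, innerSL_apply_norm]
    rw [Real.norm_of_nonneg (by positivity : 0 ≤ (‖u‖ ^ 2) ^ (k + 1)),
      Real.norm_of_nonneg (by positivity : 0 ≤ ((k + 1 : ℕ) : ℝ) * (‖u‖ ^ 2) ^ k),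
      Real.norm_of_nonneg zero_le_two]
    calc ‖⟪a, u⟫‖ * (((k + 1 : ℕ) : ℝ) * (‖u‖ ^ 2) ^ k * (2 * ‖u‖)) + (‖u‖ ^ 2) ^ (k + 1) * ‖a‖
        ≤ ‖a‖ * ‖u‖ * (((k + 1 : ℕ) : ℝ) * (‖u‖ ^ 2) ^ k * (2 * ‖u‖))
          + (‖u‖ ^ 2) ^ (k + 1) * ‖a‖ := by
          gcongr; exact norm_inner_le_norm _ _
      _ = (2 * (k + 1) + 1) * ‖a‖ * ‖u‖ ^ (2 * (k + 1)) := by rw [pow_mul]; push_cast; ring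
      _ ≤ (2 * (k + 1) + 1) * ‖a‖ * (1 + ‖u‖) ^ (2 * (k + 1)) := by gcongr; linarith
      _ ≤ _ := by gcongr <;> [linarith; omega]

theorem integral_norm_pow_succ_stdGaussian (k : ℕ) :
    ∫ u : E n, ‖u‖ ^ (2 * (k + 1)) ∂stdGaussian (E n)
      = ∑ i, ∫ u : E n, ⟪EuclideanSpace.basisFun (Fin n) ℝ i, u⟫ ^ 2 * ‖u‖ ^ (2 * k)
          ∂stdGaussian (E n) := by
  rw [← integral_finsetSum _ fun i _ => integrable_inner_sq_mul_norm_pow_stdGaussian _ _]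
  refine integral_congr_ae (Filter.Eventually.of_forall fun u => ?_)
  simp only
  rw [← Finset.sum_mul, (EuclideanSpace.basisFun (Fin n) ℝ).sum_sq_inner_right]
  ring

theorem integral_inner_sq_stdGaussian (a : E n) :
    ∫ u, ⟪a, u⟫ ^ 2 ∂stdGaussian (E n) = ‖a‖ ^ 2 := by
  simp only [pow_two]
  rw [integral_inner_mul_inner_stdGaussian, real_inner_self_eq_norm_mul_norm]

theorem integral_norm_sq_stdGaussian : ∫ u : E n, ‖u‖ ^ 2 ∂stdGaussian (E n) = n := by
  have h := integral_norm_pow_succ_stdGaussian (n := n) 0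
  simpa [integral_inner_sq_stdGaussian] using h

theorem integral_inner_sq_mul_norm_sq_stdGaussian (a : E n) :
    ∫ u, ⟪a, u⟫ ^ 2 * ‖u‖ ^ 2 ∂stdGaussian (E n) = (n + 2) * ‖a‖ ^ 2 := by
  have h := integral_inner_sq_mul_norm_pow_succ_stdGaussian a 0
  simp only [zero_add, mul_one, mul_zero, pow_zero, integral_norm_sq_stdGaussian,
    integral_inner_sq_stdGaussian] at h
  rw [h]; push_cast; ring

theorem integral_norm_pow_four_stdGaussian :
    ∫ u : E n, ‖u‖ ^ 4 ∂stdGaussian (E n) = n * (n + 2) := by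
  have h := integral_norm_pow_succ_stdGaussian (n := n) 1
  norm_num [integral_inner_sq_mul_norm_sq_stdGaussian] at h
  rw [h]; ring

theorem integral_norm_pow_six_stdGaussian :
    ∫ u : E n, ‖u‖ ^ 6 ∂stdGaussian (E n) = n * (n + 2) * (n + 4) := by
  have h1 : ∀ a : E n, ∫ u, ⟪a, u⟫ ^ 2 * ‖u‖ ^ 4 ∂stdGaussian (E n)
      = (n + 2) * (n + 4) * ‖a‖ ^ 2 := fun a => by
    have h := integral_inner_sq_mul_norm_pow_succ_stdGaussian a 1
    norm_num [integral_inner_sq_mul_norm_sq_stdGaussian, integral_norm_pow_four_stdGaussian] at h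
    rw [h]; ring
  have h := integral_norm_pow_succ_stdGaussian (n := n) 2
  norm_num [h1] at h
  rw [h]; ring

end Gaussian

/-! ### Gaussian difference quotients of a fixed function -/

namespace IsC11

variable {n : ℕ} {L μ : ℝ} {f : E n → ℝ}

theorem abs_quotient_sub_inner_le (hf : IsC11 L f) (hμ : 0 < μ) (x u : E n) :
    |(f (x + μ • u) - f x) / μ - ⟪gradient f x, u⟫| ≤ μ * L / 2 * ‖u‖ ^ 2 := by
  have h := hf.abs_sub_sub_inner_le x (μ • u)
  rw [real_inner_smul_right, norm_smul, Real.norm_of_nonneg hμ.le] at h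
  have h1 : (f (x + μ • u) - f x) / μ - ⟪gradient f x, u⟫
      = (f (x + μ • u) - f x - μ * ⟪gradient f x, u⟫) / μ := by field_simp
  rw [h1, abs_div, abs_of_pos hμ, div_le_iff₀ hμ]
  linarith

theorem abs_quotient_le (hf : IsC11 L f) (hμ : 0 < μ) (x u : E n) :
    |(f (x + μ • u) - f x) / μ| ≤ ‖gradient f x‖ * ‖u‖ + μ * L / 2 * ‖u‖ ^ 2 := by
  have h1 := abs_le.1 (hf.abs_quotient_sub_inner_le hμ x u)
  have h2 := abs_le.1 (abs_real_inner_le_norm (gradient f x) u)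
  rw [abs_le]
  constructor <;> linarith

/-- The term `⟨∇f, u⟩²‖u‖²` is kept instead of `‖∇f‖²‖u‖⁴`: its mean has the factor `n + 2` rather
than `n(n + 2)`. -/
theorem sq_norm_quotient_smul_le (hf : IsC11 L f) (hμ : 0 < μ) (x u : E n) :
    ‖((f (x + μ • u) - f x) / μ) • u‖ ^ 2
      ≤ 2 * (⟪gradient f x, u⟫ ^ 2 * ‖u‖ ^ 2) + μ ^ 2 * L ^ 2 / 2 * ‖u‖ ^ 6 := by
  set q := (f (x + μ • u) - f x) / μ with hq
  have h1 : (q - ⟪gradient f x, u⟫) ^ 2 ≤ (μ * L / 2 * ‖u‖ ^ 2) ^ 2 :=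
    sq_le_sq' (abs_le.1 (hf.abs_quotient_sub_inner_le hμ x u)).1
      (abs_le.1 (hf.abs_quotient_sub_inner_le hμ x u)).2
  have h2 : q ^ 2 ≤ 2 * ⟪gradient f x, u⟫ ^ 2 + 2 * (μ * L / 2 * ‖u‖ ^ 2) ^ 2 := by
    -- With `a = ⟨∇f(x), u⟩`, the difference `2a² + 2(q - a)² - q²` is the square `(q - 2a)²`.
    nlinarith [sq_nonneg (q - 2 * ⟪gradient f x, u⟫)]
  rw [norm_smul, mul_pow, Real.norm_eq_abs, sq_abs]
  calc q ^ 2 * ‖u‖ ^ 2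
      ≤ (2 * ⟪gradient f x, u⟫ ^ 2 + 2 * (μ * L / 2 * ‖u‖ ^ 2) ^ 2) * ‖u‖ ^ 2 := by gcongr
    _ = _ := by ring

theorem integrable_sq_norm_quotient_smul (hf : IsC11 L f) (hμ : 0 < μ) (x : E n) :
    Integrable (fun u => ‖((f (x + μ • u) - f x) / μ) • u‖ ^ 2) (stdGaussian (E n)) := by
  have hc := hf.continuous
  refine Integrable.mono' (((integrable_inner_sq_mul_norm_pow_stdGaussian (gradient f x) 2).const_mul
    2).add ((integrable_norm_pow_stdGaussian 6).const_mul (μ ^ 2 * L ^ 2 / 2)))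
    (Continuous.aestronglyMeasurable (by fun_prop)) (Filter.Eventually.of_forall fun u => ?_)
  rw [Real.norm_of_nonneg (by positivity)]
  exact hf.sq_norm_quotient_smul_le hμ x u

theorem integral_sq_norm_quotient_smul_le (hf : IsC11 L f) (hμ : 0 < μ) (x : E n) :
    ∫ u, ‖((f (x + μ • u) - f x) / μ) • u‖ ^ 2 ∂stdGaussian (E n)
      ≤ 2 * (n + 4) * ‖gradient f x‖ ^ 2 + μ ^ 2 * L ^ 2 / 2 * (n + 4) ^ 3 := by
  have h1 := (integrable_inner_sq_mul_norm_pow_stdGaussian (gradient f x) 2).const_mul 2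
  have h2 := (integrable_norm_pow_stdGaussian (n := n) 6).const_mul (μ ^ 2 * L ^ 2 / 2)
  have hn : (0 : ℝ) ≤ n := n.cast_nonneg
  calc ∫ u, ‖((f (x + μ • u) - f x) / μ) • u‖ ^ 2 ∂stdGaussian (E n)
      ≤ ∫ u, (2 * (⟪gradient f x, u⟫ ^ 2 * ‖u‖ ^ 2) + μ ^ 2 * L ^ 2 / 2 * ‖u‖ ^ 6)
        ∂stdGaussian (E n) :=
        integral_mono (hf.integrable_sq_norm_quotient_smul hμ x) (h1.add h2)
          (hf.sq_norm_quotient_smul_le hμ x)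
    _ = 2 * ((n + 2) * ‖gradient f x‖ ^ 2) + μ ^ 2 * L ^ 2 / 2 * (n * (n + 2) * (n + 4)) := by
        rw [integral_add h1 h2, integral_const_mul, integral_const_mul,
          integral_inner_sq_mul_norm_sq_stdGaussian, integral_norm_pow_six_stdGaussian]
    _ ≤ 2 * ((n + 4) * ‖gradient f x‖ ^ 2) + μ ^ 2 * L ^ 2 / 2 * ((n + 4) * (n + 4) * (n + 4)) := by
        gcongr <;> linarith
    _ = _ := by ring

theorem integrable_inner_mul_quotient (hf : IsC11 L f) (hμ : 0 < μ) (x v : E n) :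
    Integrable (fun u => ⟪v, u⟫ * ((f (x + μ • u) - f x) / μ)) (stdGaussian (E n)) := by
  have hc := hf.continuous
  refine Integrable.mono' (((integrable_norm_pow_stdGaussian (n := n) 2).const_mul
    (‖v‖ * ‖gradient f x‖)).add ((integrable_norm_pow_stdGaussian 3).const_mul
      (‖v‖ * (μ * L / 2))))
    (Continuous.aestronglyMeasurable (by fun_prop)) (Filter.Eventually.of_forall fun u => ?_)
  rw [norm_mul, Real.norm_eq_abs, Real.norm_eq_abs]
  calc |⟪v, u⟫| * |(f (x + μ • u) - f x) / μ|
      ≤ (‖v‖ * ‖u‖) * (‖gradient f x‖ * ‖u‖ + μ * L / 2 * ‖u‖ ^ 2) :=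
        mul_le_mul (abs_real_inner_le_norm _ _) (hf.abs_quotient_le hμ x u) (abs_nonneg _)
          (by positivity)
    _ = _ := by simp only [Pi.add_apply]; ring

/-- The expected gradient-free estimator is a descent direction up to the smoothing error. -/
theorem le_integral_inner_gradient_mul_quotient (hf : IsC11 L f) (hμ : 0 < μ) (x : E n) :
    ‖gradient f x‖ ^ 2 / 2 - μ ^ 2 * L ^ 2 / 8 * (n + 4) ^ 2
      ≤ ∫ u, ⟪gradient f x, u⟫ * ((f (x + μ • u) - f x) / μ) ∂stdGaussian (E n) := by
  have hn : (0 : ℝ) ≤ n := n.cast_nonneg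
  have h1 : Integrable (fun u => ⟪gradient f x, u⟫ ^ 2 / 2) (stdGaussian (E n)) := by
    simpa using (integrable_inner_sq_mul_norm_pow_stdGaussian (gradient f x) 0).div_const 2
  have h2 := (integrable_norm_pow_stdGaussian (n := n) 4).const_mul (μ ^ 2 * L ^ 2 / 8)
  calc ‖gradient f x‖ ^ 2 / 2 - μ ^ 2 * L ^ 2 / 8 * (n + 4) ^ 2
      ≤ ‖gradient f x‖ ^ 2 / 2 - μ ^ 2 * L ^ 2 / 8 * (n * (n + 2)) := by
        gcongr; nlinarith
    _ = ∫ u, (⟪gradient f x, u⟫ ^ 2 / 2 - μ ^ 2 * L ^ 2 / 8 * ‖u‖ ^ 4) ∂stdGaussian (E n) := by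
        rw [integral_sub h1 h2, integral_const_mul, integral_norm_pow_four_stdGaussian,
          integral_div, integral_inner_sq_stdGaussian]
    _ ≤ _ := by
        refine integral_mono (h1.sub h2) (hf.integrable_inner_mul_quotient hμ x _) fun u => ?_
        simp only
        set a := ⟪gradient f x, u⟫
        set q := (f (x + μ • u) - f x) / μ
        have h3 : (q - a) ^ 2 ≤ (μ * L / 2 * ‖u‖ ^ 2) ^ 2 :=
          sq_le_sq' (abs_le.1 (hf.abs_quotient_sub_inner_le hμ x u)).1
            (abs_le.1 (hf.abs_quotient_sub_inner_le hμ x u)).2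
        -- Here `aq = (a² + q² - (q - a)²)/2`, and `q²/2` is dropped.
        nlinarith [sq_nonneg q]

/-- Integration by parts in `u`: the quotient has gradient `∇f(x + μu)` with respect to `u`, since
the inner factor `μ` cancels the denominator. Thus the estimator averages to the gradient of the
Gaussian smoothing of `f`. -/
theorem integral_inner_mul_quotient_eq (hf : IsC11 L f) (hL : 0 ≤ L) (hμ : 0 < μ) (x v : E n) :
    ∫ u, ⟪v, u⟫ * ((f (x + μ • u) - f x) / μ) ∂stdGaussian (E n)
      = ∫ u, ⟪gradient f (x + μ • u), v⟫ ∂stdGaussian (E n) := by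
  have hd : ∀ u, HasFDerivAt (fun u => (f (x + μ • u) - f x) / μ)
      (InnerProductSpace.toDual ℝ (E n) (gradient f (x + μ • u))) u := fun u => by
    have h1 : HasFDerivAt (fun u : E n => x + μ • u) (μ • ContinuousLinearMap.id ℝ (E n)) u :=
      ((hasFDerivAt_id u).const_smul μ).const_add x
    have h2 := (((hf.hasGradientAt (x + μ • u)).hasFDerivAt.comp u h1).sub_const (f x)).mul_const μ⁻¹
    simp only [div_eq_mul_inv]
    refine h2.congr_fderiv ?_
    ext w
    simp only [smul_apply, ContinuousLinearMap.comp_apply, ContinuousLinearMap.id_apply, map_smul,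
      smul_eq_mul]
    field_simp
  have h := integral_mul_inner_stdGaussian hd (C := ‖gradient f x‖ + μ * L) (p := 2)
    (fun u => ?_) (fun u => ?_) v
  · simp only [InnerProductSpace.toDual_apply_apply] at h
    rw [← h]
    simp only [mul_comm]
  · have h1 := norm_nonneg u
    have h2 := norm_nonneg (gradient f x)
    have h3 : 0 ≤ μ * L := by positivity
    refine (hf.abs_quotient_le hμ x u).trans ?_
    nlinarith [mul_nonneg h1 h2, mul_nonneg h3 h1, mul_nonneg h3 (sq_nonneg ‖u‖),
      mul_nonneg h2 (sq_nonneg ‖u‖)]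
  · have h1 := norm_nonneg u
    have h2 := norm_nonneg (gradient f x)
    have h3 : 0 ≤ μ * L := by positivity
    rw [LinearIsometryEquiv.norm_map]
    have h4 := hf.2 x (x + μ • u)
    rw [add_sub_cancel_left, norm_smul, Real.norm_of_nonneg hμ.le] at h4
    have h5 := norm_le_norm_add_norm_sub' (gradient f (x + μ • u)) (gradient f x)
    nlinarith [mul_nonneg h1 h2, mul_nonneg h3 h1, mul_nonneg h3 (sq_nonneg ‖u‖),
      mul_nonneg h2 (sq_nonneg ‖u‖)]

/-- Both points are shifted by the same `μu`, which leaves `x - y` unchanged. Convexity gives `⟨∇f(x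
+ μu), x - y⟩ ≥ f(x + μu) - f(y + μu)`; the first value is bounded below by the tangent at `x`,
whose linear term averages to zero, and the second above by the Taylor bound at the minimizer. -/
theorem le_integral_inner_sub_mul_quotient (hf : IsC11 L f) (hL : 0 ≤ L) (hμ : 0 < μ)
    (hc : ConvexOn ℝ Set.univ f) {y : E n} (hy : IsMinOn f Set.univ y) (x : E n) :
    f x - f y - μ ^ 2 * L / 2 * n
      ≤ ∫ u, ⟪x - y, u⟫ * ((f (x + μ • u) - f x) / μ) ∂stdGaussian (E n) := by
  rw [hf.integral_inner_mul_quotient_eq hL hμ]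
  have hcg := hf.continuous_gradient
  have h1 : Integrable (fun u => ⟪gradient f (x + μ • u), x - y⟫) (stdGaussian (E n)) := by
    refine integrable_stdGaussian_of_le (C := (‖gradient f x‖ + μ * L) * ‖x - y‖) (p := 1)
      (Continuous.aestronglyMeasurable (by fun_prop)) fun u => ?_
    refine (abs_real_inner_le_norm _ _).trans ?_
    have h4 := hf.2 x (x + μ • u)
    rw [add_sub_cancel_left, norm_smul, Real.norm_of_nonneg hμ.le] at h4
    have h5 := norm_le_norm_add_norm_sub' (gradient f (x + μ • u)) (gradient f x)
    rw [mul_right_comm]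
    gcongr
    have h2 := mul_nonneg (norm_nonneg (gradient f x)) (norm_nonneg u)
    have h3 : 0 ≤ μ * L := by positivity
    nlinarith
  have h2 : Integrable (fun u : E n => f x - f y + μ * ⟪gradient f x, u⟫) (stdGaussian (E n)) :=
    (integrable_const _).add ((IsGaussian.integrable_fun_id.const_inner _).const_mul _)
  have h2' : Integrable (fun u : E n => μ * ⟪gradient f x, u⟫) (stdGaussian (E n)) :=
    (IsGaussian.integrable_fun_id.const_inner _).const_mul _
  have h3 := (integrable_norm_pow_stdGaussian (n := n) 2).const_mul (μ ^ 2 * L / 2)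
  calc f x - f y - μ ^ 2 * L / 2 * n
      = ∫ u, (f x - f y + μ * ⟪gradient f x, u⟫ - μ ^ 2 * L / 2 * ‖u‖ ^ 2)
        ∂stdGaussian (E n) := by
        rw [integral_sub h2 h3, integral_add (integrable_const _) h2', integral_const_mul,
          integral_const_mul, integral_inner_stdGaussian, integral_norm_sq_stdGaussian]
        simp
    _ ≤ _ := by
        refine integral_mono (h2.sub h3) h1 fun u => ?_
        have a1 := hf.inner_le_of_convexOn hc (x + μ • u) (y + μ • u)
        have a2 := hf.inner_le_of_convexOn hc x (x + μ • u)
        have a3 := (abs_le.1 (hf.abs_sub_sub_inner_le y (μ • u))).2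
        rw [gradient_eq_zero_of_isMinOn hy, inner_zero_left, norm_smul,
          Real.norm_of_nonneg hμ.le] at a3
        rw [add_sub_cancel_left, real_inner_smul_right] at a2
        rw [show y + μ • u - (x + μ • u) = -(x - y) by abel, inner_neg_right] at a1
        simp only
        nlinarith

end IsC11

/-! ### From deterministic to past-dependent points -/

section Freezing

variable {n : ℕ} {Ω : Type u}

/-- The bound by `2‖X‖` is what makes dominated convergence possible along the approximation. -/
theorem exists_finite_range_tendsto_norm_le [MeasurableSpace Ω] {X : Ω → E n} (hX : Measurable X) :
    ∃ (S : ℕ → Ω → E n) (R : ℕ → Finset (E n)), (∀ j ω, S j ω ∈ R j) ∧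
      (∀ j a, MeasurableSet (S j ⁻¹' {a})) ∧
      (∀ ω, Filter.Tendsto (fun j => S j ω) Filter.atTop (nhds (X ω))) ∧
      ∀ j ω, ‖S j ω‖ ≤ 2 * ‖X ω‖ := by
  let S := SimpleFunc.approxOn X hX Set.univ 0 (Set.mem_univ 0)
  refine ⟨fun j => S j, fun j => (S j).range, fun j ω => SimpleFunc.mem_range_self _ ω,
    fun j a => (S j).measurableSet_fiber a, fun ω => ?_, fun j ω => ?_⟩
  · exact SimpleFunc.tendsto_approxOn _ _ (by simp)
  · have := SimpleFunc.norm_approxOn_zero_le hX (Set.mem_univ (0 : E n)) ω j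
    linarith

variable {m m0 : MeasurableSpace Ω} {Pr : Measure[m0] Ω}

/-- A bound for the averages of a random field on the events of a σ-algebra, at deterministic
points, extends to random points that are measurable for this σ-algebra. -/
theorem integral_comp_le_of_setIntegral_le [IsProbabilityMeasure Pr] (hm : m ≤ m0)
    {T : E n → Ω → ℝ} {X : Ω → E n} (hX : Measurable[m] X) {B : Ω → ℝ} (hB : Integrable B Pr)
    (hTi : ∀ a, Integrable (T a) Pr) (hc : ∀ᵐ ω ∂Pr, Continuous fun a => T a ω)
    (hb : ∀ᵐ ω ∂Pr, ∀ a, ‖a‖ ≤ 2 * ‖X ω‖ → |T a ω| ≤ B ω) {κ : ℝ}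
    (hκ : ∀ a A, MeasurableSet[m] A → ∫ ω in A, T a ω ∂Pr ≤ κ * Pr.real A) :
    Integrable (fun ω => T (X ω) ω) Pr ∧ ∫ ω, T (X ω) ω ∂Pr ≤ κ := by
  -- The approximants are taken measurable for `m`, not only for `m0`, so that `hκ` applies on their
  -- level sets.
  obtain ⟨S, R, hR, hA, hS, hSn⟩ := @exists_finite_range_tendsto_norm_le n Ω m X hX
  have hsum : ∀ j, (fun ω => T (S j ω) ω)
      = fun ω => ∑ a ∈ R j, (S j ⁻¹' {a}).indicator (T a) ω := fun j => by
    funext ω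
    rw [Finset.sum_eq_single (S j ω)]
    · simp
    · intro a _ ha
      exact Set.indicator_of_notMem (fun h => ha h.symm) _
    · intro h
      exact absurd (hR j ω) h
  have hint : ∀ j a, Integrable ((S j ⁻¹' {a}).indicator (T a)) Pr := fun j a =>
    (hTi a).indicator (hm _ (hA j a))
  have hSi : ∀ j, Integrable (fun ω => T (S j ω) ω) Pr := fun j => by
    rw [hsum j]
    exact integrable_finsetSum _ fun a _ => hint j a
  have hle : ∀ j, ∫ ω, T (S j ω) ω ∂Pr ≤ κ := fun j => by
    have h1 : ∑ a ∈ R j, Pr.real (S j ⁻¹' {a}) = 1 := by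
      have h2 := integral_finsetSum (μ := Pr) (R j)
        (f := fun a => (S j ⁻¹' {a}).indicator (fun _ => (1 : ℝ)))
        (fun a _ => (integrable_const _).indicator (hm _ (hA j a)))
      have h3 : ∀ ω, ∑ a ∈ R j, (S j ⁻¹' {a}).indicator (fun _ => (1 : ℝ)) ω = 1 := by
        intro ω
        rw [Finset.sum_eq_single (S j ω)]
        · simp
        · intro a _ ha
          exact Set.indicator_of_notMem (fun h => ha h.symm) _
        · intro h
          exact absurd (hR j ω) h
      simp only [h3] at h2
      rw [integral_const, probReal_univ, one_smul] at h2
      rw [h2]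
      refine Finset.sum_congr rfl fun a _ => ?_
      rw [integral_indicator (hm _ (hA j a))]
      simp
    -- On each level set the point is deterministic; the bounds `κ * Pr.real` add up to `κ` because
    -- the level sets partition the space.
    calc ∫ ω, T (S j ω) ω ∂Pr = ∑ a ∈ R j, ∫ ω in S j ⁻¹' {a}, T a ω ∂Pr := by
          rw [hsum j, integral_finsetSum _ fun a _ => hint j a]
          exact Finset.sum_congr rfl fun a _ => integral_indicator (hm _ (hA j a))
      _ ≤ ∑ a ∈ R j, κ * Pr.real (S j ⁻¹' {a}) :=
          Finset.sum_le_sum fun a _ => hκ a _ (hA j a)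
      _ = κ := by rw [← Finset.mul_sum, h1, mul_one]
  have hlim : ∀ᵐ ω ∂Pr, Filter.Tendsto (fun j => T (S j ω) ω) Filter.atTop (nhds (T (X ω) ω)) := by
    filter_upwards [hc] with ω h using (h.tendsto (X ω)).comp (hS ω)
  have hbd : ∀ j, ∀ᵐ ω ∂Pr, ‖T (S j ω) ω‖ ≤ B ω := fun j => by
    filter_upwards [hb] with ω h using h _ (hSn j ω)
  refine ⟨hB.mono' (aestronglyMeasurable_of_tendsto_ae Filter.atTop
    (fun j => (hSi j).aestronglyMeasurable) hlim) ?_, ?_⟩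
  · filter_upwards [hb] with ω h
    exact h _ (by linarith [norm_nonneg (X ω)])
  · exact le_of_tendsto (tendsto_integral_of_dominated_convergence B
      (fun j => (hSi j).aestronglyMeasurable) hB hbd hlim) (Filter.Eventually.of_forall hle)

variable {H : Type*} [NormedAddCommGroup H] [InnerProductSpace ℝ H]

theorem MeasureTheory.MemLp.integrable_real_inner {c D : Ω → H} (hc : MemLp c 2 Pr)
    (hD : MemLp D 2 Pr) : Integrable (fun ω => ⟪c ω, D ω⟫) Pr :=
  (hc.norm.integrable_mul hD.norm).mono' (hc.aestronglyMeasurable.inner hD.aestronglyMeasurable)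
    (Filter.Eventually.of_forall fun _ => norm_inner_le_norm _ _)

/-- The factor `c` is known given `m` and can be pulled out of the conditional expectation. -/
theorem setIntegral_inner_eq_zero [IsProbabilityMeasure Pr] [CompleteSpace H] (hm : m ≤ m0) {c D : Ω → H}
    (hc : StronglyMeasurable[m] c) (hc2 : MemLp c 2 Pr) (hD2 : MemLp D 2 Pr)
    (hD : Pr[D | m] =ᵐ[Pr] 0) {A : Set Ω} (hA : MeasurableSet[m] A) :
    ∫ ω in A, ⟪c ω, D ω⟫ ∂Pr = 0 := by
  have hi : Integrable (fun ω => ⟪c ω, D ω⟫) Pr := hc2.integrable_real_inner hD2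
  rw [← setIntegral_condExp hm hi hA]
  have h1 := condExp_bilin_of_stronglyMeasurable_left (innerSL ℝ) hc hi (hD2.integrable one_le_two)
  have h2 : Pr[fun ω => ⟪c ω, D ω⟫ | m] =ᵐ[Pr] 0 := by
    filter_upwards [h1, hD] with ω h1 h2
    rw [innerSL_apply_apply] at h1
    rw [h2, Pi.zero_apply, inner_zero_right] at h1
    exact h1
  rw [integral_congr_ae (ae_restrict_of_ae h2)]
  simp

/-- A Lipschitz random field with vanishing conditional expectations at deterministic points is
orthogonal to the past also at random points that depend on the past. -/
theorem integral_inner_comp_eq_zero [IsProbabilityMeasure Pr] [CompleteSpace H] (hm : m ≤ m0)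
    {Z : E n → Ω → H} {K : ℝ} (hZ2 : ∀ a, MemLp (Z a) 2 Pr) (hZ : ∀ a, Pr[Z a | m] =ᵐ[Pr] 0)
    (hlip : ∀ᵐ ω ∂Pr, ∀ a b, ‖Z a ω - Z b ω‖ ≤ K * ‖a - b‖) {X : Ω → E n} (hX : Measurable[m] X)
    (hX2 : MemLp X 2 Pr) {c : Ω → H} (hc : StronglyMeasurable[m] c) (hc2 : MemLp c 2 Pr) :
    Integrable (fun ω => ⟪c ω, Z (X ω) ω⟫) Pr ∧ ∫ ω, ⟪c ω, Z (X ω) ω⟫ ∂Pr = 0 := by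
  have hlip' : ∀ᵐ ω ∂Pr, ∀ a b, ‖Z a ω - Z b ω‖ ≤ |K| * ‖a - b‖ := by
    filter_upwards [hlip] with ω h a b using (h a b).trans (by gcongr; exact le_abs_self K)
  have hb : MemLp (fun ω => ‖Z 0 ω‖ + 2 * |K| * ‖X ω‖) 2 Pr := (hZ2 0).norm.add (hX2.norm.const_mul _)
  have hB : Integrable (fun ω => ‖c ω‖ * (‖Z 0 ω‖ + 2 * |K| * ‖X ω‖)) Pr :=
    hc2.norm.integrable_mul hb
  have hcont : ∀ᵐ ω ∂Pr, Continuous fun a => ⟪c ω, Z a ω⟫ := by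
    filter_upwards [hlip'] with ω h
    have : LipschitzWith |K|.toNNReal fun a => Z a ω := LipschitzWith.of_dist_le_mul fun a b => by
      rw [dist_eq_norm, dist_eq_norm, Real.coe_toNNReal _ (abs_nonneg K)]
      exact h a b
    exact continuous_const.inner this.continuous
  have hbound : ∀ᵐ ω ∂Pr, ∀ a, ‖a‖ ≤ 2 * ‖X ω‖ →
      |⟪c ω, Z a ω⟫| ≤ ‖c ω‖ * (‖Z 0 ω‖ + 2 * |K| * ‖X ω‖) := by
    filter_upwards [hlip'] with ω h a ha
    refine (abs_real_inner_le_norm _ _).trans ?_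
    gcongr
    have h1 := h a 0
    have h2 := norm_le_norm_add_norm_sub' (Z a ω) (Z 0 ω)
    rw [sub_zero] at h1
    have h3 := mul_le_mul_of_nonneg_left ha (abs_nonneg K)
    linarith
  -- The one-sided freezing bound is applied with `κ = 0` to the field and to its negative.
  have h1 := integral_comp_le_of_setIntegral_le hm (T := fun a ω => ⟪c ω, Z a ω⟫) hX hB
    (fun a => hc2.integrable_real_inner (hZ2 a)) hcont hbound (κ := 0)
    (fun a A hA => by rw [setIntegral_inner_eq_zero hm hc hc2 (hZ2 a) (hZ a) hA, zero_mul])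
  have h2 := integral_comp_le_of_setIntegral_le hm (T := fun a ω => -⟪c ω, Z a ω⟫) hX hB
    (fun a => (hc2.integrable_real_inner (hZ2 a)).neg)
    (by filter_upwards [hcont] with ω h using h.neg)
    (by filter_upwards [hbound] with ω h a ha using by rw [abs_neg]; exact h a ha) (κ := 0)
    (fun a A hA => by
      rw [integral_neg, setIntegral_inner_eq_zero hm hc hc2 (hZ2 a) (hZ a) hA, zero_mul, neg_zero])
  refine ⟨h1.1, le_antisymm h1.2 ?_⟩
  have h3 := h2.2
  rw [integral_neg] at h3
  linarith

end Freezing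

/-- One call of the stochastic zeroth-order oracle, with sample `s` and direction `w`, at a random
point `X` that depends on the past `m` only. -/
structure IsOracleCall {n : ℕ} {Ω : Type u} {Ξ : Type v} (m : MeasurableSpace Ω)
    {m0 : MeasurableSpace Ω} [MeasurableSpace Ξ] (Pr : Measure Ω) (F : E n → Ξ → ℝ) (f : E n → ℝ)
    (L σ : ℝ) (s : Ω → Ξ) (w X : Ω → E n) : Prop where
  le : m ≤ m0
  nonneg : 0 ≤ L
  measurable : Measurable (Function.uncurry F)
  smooth : ∀ᵐ ω ∂Pr, IsC11 L (fun x => F x (s ω))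
  isC11 : IsC11 L f
  measurable_sample : Measurable s
  measurable_dir : Measurable w
  measurable_point : Measurable[m] X
  memLp_point : MemLp X 2 Pr
  integrable_value : ∀ x, Integrable (fun ω => F x (s ω)) Pr
  condExp_value : ∀ x, Pr[fun ω => F x (s ω) | m] =ᵐ[Pr] fun _ => f x
  integrable_grad : ∀ x, Integrable (fun ω => stochGrad F x (s ω)) Pr
  condExp_grad : ∀ x, Pr[fun ω => stochGrad F x (s ω) | m] =ᵐ[Pr] fun _ => gradient f x
  integrable_sq : ∀ x, Integrable (fun ω => ‖stochGrad F x (s ω) - gradient f x‖ ^ 2) Pr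
  condExp_sq_le : ∀ x, Pr[fun ω => ‖stochGrad F x (s ω) - gradient f x‖ ^ 2 | m]
    ≤ᵐ[Pr] fun _ => σ ^ 2
  map_dir : Pr.map w = stdGaussian (E n)
  indep : IndepFun w (fun ω => (s ω, X ω)) Pr

/-! ### The gradient-free estimator at a random point -/

namespace IsOracleCall

variable {n : ℕ} {Ω : Type u} {Ξ : Type v} {m m0 : MeasurableSpace Ω} [MeasurableSpace Ξ]
  {Pr : Measure[m0] Ω} {F : E n → Ξ → ℝ} {f : E n → ℝ} {L σ μ : ℝ}
  {s : Ω → Ξ} {w X : Ω → E n}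

theorem norm_error_sub_le (h : IsOracleCall m Pr F f L σ s w X) :
    ∀ᵐ ω ∂Pr, ∀ a b, ‖stochGrad F a (s ω) - gradient f a - (stochGrad F b (s ω) - gradient f b)‖
      ≤ (L + L) * ‖a - b‖ := by
  filter_upwards [h.smooth] with ω hω a b
  have h1 := (hω.sub h.isC11).2 b a
  rwa [hω.gradient_sub h.isC11, hω.gradient_sub h.isC11] at h1

variable [IsProbabilityMeasure Pr]

theorem memLp_error (h : IsOracleCall m Pr F f L σ s w X) (a : E n) :
    MemLp (fun ω => stochGrad F a (s ω) - gradient f a) 2 Pr :=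
  (memLp_two_iff_integrable_sq_norm
    ((h.integrable_grad a).sub (integrable_const _)).aestronglyMeasurable).2 (h.integrable_sq a)

theorem condExp_error (h : IsOracleCall m Pr F f L σ s w X) (a : E n) :
    Pr[fun ω => stochGrad F a (s ω) - gradient f a | m] =ᵐ[Pr] 0 := by
  have h1 := condExp_sub (h.integrable_grad a) (integrable_const (gradient f a)) m
  filter_upwards [h1, h.condExp_grad a] with ω h1 h2
  rw [condExp_const h.le] at h1
  rw [Pi.sub_apply, h2, sub_self] at h1
  exact h1

theorem memLp_gradient (h : IsOracleCall m Pr F f L σ s w X) :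
    MemLp (fun ω => gradient f (X ω)) 2 Pr := by
  have hb : MemLp (fun ω => ‖gradient f 0‖ + L * ‖X ω‖) 2 Pr :=
    (memLp_const ‖gradient f 0‖).add (h.memLp_point.norm.const_mul L)
  exact hb.mono'
    (h.isC11.continuous_gradient.comp_aestronglyMeasurable h.memLp_point.aestronglyMeasurable)
    (Filter.Eventually.of_forall fun ω => h.isC11.norm_gradient_le _)

/-- The conditional variance bound is assumed at fixed points; the error is `2L`-Lipschitz in the
point, so freezing carries the bound over to `X`. -/
theorem integrable_sq_norm_error_comp (h : IsOracleCall m Pr F f L σ s w X) :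
    Integrable (fun ω => ‖stochGrad F (X ω) (s ω) - gradient f (X ω)‖ ^ 2) Pr ∧
      ∫ ω, ‖stochGrad F (X ω) (s ω) - gradient f (X ω)‖ ^ 2 ∂Pr ≤ σ ^ 2 := by
  have hL := h.nonneg
  have hb : MemLp (fun ω => ‖stochGrad F 0 (s ω) - gradient f 0‖ + 2 * (L + L) * ‖X ω‖) 2 Pr :=
    (h.memLp_error 0).norm.add (h.memLp_point.norm.const_mul _)
  refine integral_comp_le_of_setIntegral_le h.le
    (T := fun a ω => ‖stochGrad F a (s ω) - gradient f a‖ ^ 2) h.measurable_point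
    hb.integrable_sq h.integrable_sq ?_ ?_ ?_
  · filter_upwards [h.norm_error_sub_le] with ω hω
    have : LipschitzWith (L + L).toNNReal fun a => stochGrad F a (s ω) - gradient f a :=
      LipschitzWith.of_dist_le_mul fun a b => by
        rw [dist_eq_norm, dist_eq_norm, Real.coe_toNNReal _ (by linarith)]
        exact hω a b
    exact this.continuous.norm.pow 2
  · filter_upwards [h.norm_error_sub_le] with ω hω a ha
    rw [abs_of_nonneg (by positivity)]
    gcongr
    have h1 := hω a 0
    have h2 := norm_le_norm_add_norm_sub' (stochGrad F a (s ω) - gradient f a)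
      (stochGrad F 0 (s ω) - gradient f 0)
    rw [sub_zero] at h1
    have h3 := mul_le_mul_of_nonneg_left ha (by linarith : 0 ≤ L + L)
    linarith
  · intro a A hA
    rw [← setIntegral_condExp h.le (h.integrable_sq a) hA]
    calc _ ≤ ∫ _ in A, σ ^ 2 ∂Pr :=
          setIntegral_mono_ae integrable_condExp.integrableOn (integrable_const _).integrableOn
            (h.condExp_sq_le a)
      _ = _ := by simp [mul_comm]

/-- Pythagoras: `∇f(X)` depends on the past only and is orthogonal to the error at `X`. -/
theorem integrable_sq_norm_stochGrad_comp (h : IsOracleCall m Pr F f L σ s w X) :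
    Integrable (fun ω => ‖stochGrad F (X ω) (s ω)‖ ^ 2) Pr ∧
      ∫ ω, ‖stochGrad F (X ω) (s ω)‖ ^ 2 ∂Pr ≤ ∫ ω, ‖gradient f (X ω)‖ ^ 2 ∂Pr + σ ^ 2 := by
  obtain ⟨i1, e1⟩ := h.integrable_sq_norm_error_comp
  have hsm : StronglyMeasurable[m] fun ω => gradient f (X ω) :=
    (h.isC11.continuous_gradient.measurable.comp h.measurable_point).stronglyMeasurable
  obtain ⟨i2, e2⟩ := integral_inner_comp_eq_zero h.le h.memLp_error h.condExp_error
    h.norm_error_sub_le h.measurable_point h.memLp_point hsm h.memLp_gradient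
  have i3 := h.memLp_gradient.integrable_norm_pow two_ne_zero
  have hd : ∀ ω, ‖stochGrad F (X ω) (s ω)‖ ^ 2 = ‖gradient f (X ω)‖ ^ 2
      + 2 * ⟪gradient f (X ω), stochGrad F (X ω) (s ω) - gradient f (X ω)⟫
      + ‖stochGrad F (X ω) (s ω) - gradient f (X ω)‖ ^ 2 := fun ω => by
    rw [← norm_add_sq_real]; congr 2; abel
  simp only [hd]
  refine ⟨(i3.add (i2.const_mul 2)).add i1, ?_⟩
  rw [integral_add (f := fun ω => ‖gradient f (X ω)‖ ^ 2
      + 2 * ⟪gradient f (X ω), stochGrad F (X ω) (s ω) - gradient f (X ω)⟫)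
      (i3.add (i2.const_mul 2)) i1, integral_add i3 (i2.const_mul 2), integral_const_mul, e2]
  linarith

/-- Independence allows `w` to be replaced by a fresh Gaussian on a product space, while `s` and `X`
stay coupled on `Ω`. Fubini then applies. -/
theorem map_eq_map_prod (h : IsOracleCall m Pr F f L σ s w X) :
    Pr.map (fun ω => (w ω, (s ω, X ω)))
      = ((stdGaussian (E n)).prod Pr).map (fun z => (z.1, (s z.2, X z.2))) := by
  have hX : Measurable X := h.measurable_point.mono h.le le_rfl
  have hsX : Measurable fun ω => (s ω, X ω) := h.measurable_sample.prodMk hX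
  have h1 := (indepFun_iff_map_prod_eq_prod_map_map h.measurable_dir.aemeasurable
    hsX.aemeasurable).1 h.indep
  rw [h1, h.map_dir]
  have h2 := Measure.map_prod_map (stdGaussian (E n)) Pr measurable_id hsX
  rw [Measure.map_id] at h2
  exact h2

theorem integrable_iff_prod (h : IsOracleCall m Pr F f L σ s w X) {g : E n × (Ξ × E n) → ℝ}
    (hg : Measurable g) : Integrable (fun ω => g (w ω, (s ω, X ω))) Pr ↔
      Integrable (fun z : E n × Ω => g (z.1, (s z.2, X z.2))) ((stdGaussian (E n)).prod Pr) := by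
  have hX : Measurable X := h.measurable_point.mono h.le le_rfl
  have hs := h.measurable_sample
  have hw := h.measurable_dir
  have h1 := integrable_map_measure (μ := Pr) (f := fun ω => (w ω, (s ω, X ω))) (g := g)
    hg.aestronglyMeasurable (by fun_prop)
  have h2 := integrable_map_measure (μ := (stdGaussian (E n)).prod Pr)
    (f := fun z => (z.1, (s z.2, X z.2))) (g := g) hg.aestronglyMeasurable (by fun_prop)
  rw [h.map_eq_map_prod] at h1
  exact h1.symm.trans h2

theorem integral_eq_prod (h : IsOracleCall m Pr F f L σ s w X) {g : E n × (Ξ × E n) → ℝ}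
    (hg : Measurable g) : ∫ ω, g (w ω, (s ω, X ω)) ∂Pr
      = ∫ z : E n × Ω, g (z.1, (s z.2, X z.2)) ∂((stdGaussian (E n)).prod Pr) := by
  have hX : Measurable X := h.measurable_point.mono h.le le_rfl
  have hs := h.measurable_sample
  have hw := h.measurable_dir
  have h1 := integral_map (μ := Pr) (φ := fun ω => (w ω, (s ω, X ω))) (f := g) (by fun_prop)
    hg.aestronglyMeasurable
  have h2 := integral_map (μ := (stdGaussian (E n)).prod Pr)
    (φ := fun z => (z.1, (s z.2, X z.2))) (f := g) (by fun_prop) hg.aestronglyMeasurable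
  rw [h.map_eq_map_prod] at h1
  exact h1.symm.trans h2

theorem measurable_gradFree (hF : Measurable (Function.uncurry F)) (μ : ℝ) :
    Measurable fun p : E n × (Ξ × E n) => gradFree F μ p.2.2 p.2.1 p.1 := by
  have h1 : Measurable fun p : E n × (Ξ × E n) => F (p.2.2 + μ • p.1) p.2.1 :=
    hF.comp (f := fun p : E n × (Ξ × E n) => (p.2.2 + μ • p.1, p.2.1)) (by fun_prop)
  have h2 : Measurable fun p : E n × (Ξ × E n) => F p.2.2 p.2.1 :=
    hF.comp (f := fun p : E n × (Ξ × E n) => (p.2.2, p.2.1)) (by fun_prop)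
  exact ((h1.sub h2).div_const μ).smul measurable_fst

/-- For almost every fixed `ω` the Gaussian bound holds for the function `F(·, s ω)`. It leaves
`‖∇F(X, s)‖²`, whose mean is controlled by the variance. -/
theorem integrable_sq_norm_gradFree (h : IsOracleCall m Pr F f L σ s w X) (hμ : 0 < μ) :
    Integrable (fun ω => ‖gradFree F μ (X ω) (s ω) (w ω)‖ ^ 2) Pr ∧
      ∫ ω, ‖gradFree F μ (X ω) (s ω) (w ω)‖ ^ 2 ∂Pr
        ≤ 2 * (n + 4) * (∫ ω, ‖gradient f (X ω)‖ ^ 2 ∂Pr + σ ^ 2)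
          + μ ^ 2 * L ^ 2 / 2 * (n + 4) ^ 3 := by
  have hg : Measurable fun p : E n × (Ξ × E n) => ‖gradFree F μ p.2.2 p.2.1 p.1‖ ^ 2 :=
    (measurable_gradFree h.measurable μ).norm.pow_const 2
  have hX : Measurable X := h.measurable_point.mono h.le le_rfl
  have hs := h.measurable_sample
  have hgm : Measurable fun z : E n × Ω => ‖gradFree F μ (X z.2) (s z.2) z.1‖ ^ 2 :=
    hg.comp (f := fun z : E n × Ω => (z.1, (s z.2, X z.2))) (by fun_prop)
  obtain ⟨i1, e1⟩ := h.integrable_sq_norm_stochGrad_comp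
  have ib : Integrable (fun ω => 2 * (n + 4) * ‖stochGrad F (X ω) (s ω)‖ ^ 2
      + μ ^ 2 * L ^ 2 / 2 * (n + 4) ^ 3) Pr := (i1.const_mul _).add (integrable_const _)
  have hle : ∀ᵐ ω ∂Pr, ∫ u, ‖gradFree F μ (X ω) (s ω) u‖ ^ 2 ∂stdGaussian (E n)
      ≤ 2 * (n + 4) * ‖stochGrad F (X ω) (s ω)‖ ^ 2 + μ ^ 2 * L ^ 2 / 2 * (n + 4) ^ 3 := by
    filter_upwards [h.smooth] with ω hω using hω.integral_sq_norm_quotient_smul_le hμ (X ω)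
  have hi : Integrable (fun z : E n × Ω => ‖gradFree F μ (X z.2) (s z.2) z.1‖ ^ 2)
      ((stdGaussian (E n)).prod Pr) := by
    rw [integrable_prod_iff' hgm.aestronglyMeasurable]
    refine ⟨?_, ?_⟩
    · filter_upwards [h.smooth] with ω hω using hω.integrable_sq_norm_quotient_smul hμ (X ω)
    · refine ib.mono' ?_ ?_
      · exact hgm.norm.stronglyMeasurable.integral_prod_left'.aestronglyMeasurable
      · filter_upwards [hle] with ω hω
        simp only [norm_pow, norm_norm]
        rwa [Real.norm_of_nonneg (integral_nonneg fun u => by positivity)]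
  refine ⟨(h.integrable_iff_prod hg).2 hi, ?_⟩
  rw [h.integral_eq_prod hg, integral_prod_symm _ hi]
  calc _ ≤ ∫ ω, (2 * (n + 4) * ‖stochGrad F (X ω) (s ω)‖ ^ 2
      + μ ^ 2 * L ^ 2 / 2 * (n + 4) ^ 3) ∂Pr := integral_mono_ae hi.integral_prod_right ib hle
    _ = 2 * (n + 4) * ∫ ω, ‖stochGrad F (X ω) (s ω)‖ ^ 2 ∂Pr
      + μ ^ 2 * L ^ 2 / 2 * (n + 4) ^ 3 := by
        rw [integral_add (i1.const_mul _) (integrable_const _), integral_const_mul]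
        simp
    _ ≤ _ := by gcongr

theorem memLp_gradFree (h : IsOracleCall m Pr F f L σ s w X) (hμ : 0 < μ) :
    MemLp (fun ω => gradFree F μ (X ω) (s ω) (w ω)) 2 Pr := by
  have hX : Measurable X := h.measurable_point.mono h.le le_rfl
  have hs := h.measurable_sample
  have hw := h.measurable_dir
  have hm : Measurable fun ω => gradFree F μ (X ω) (s ω) (w ω) :=
    (measurable_gradFree h.measurable μ).comp (f := fun ω => (w ω, (s ω, X ω))) (by fun_prop)
  exact (memLp_two_iff_integrable_sq_norm hm.aestronglyMeasurable).2
    (h.integrable_sq_norm_gradFree hμ).1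

theorem condExp_value_error (h : IsOracleCall m Pr F f L σ s w X) (a : E n) :
    Pr[fun ω => F a (s ω) - f a | m] =ᵐ[Pr] 0 := by
  have h1 := condExp_sub (h.integrable_value a) (integrable_const (f a)) m
  filter_upwards [h1, h.condExp_value a] with ω h1 h2
  rw [condExp_const h.le] at h1
  rw [Pi.sub_apply, h2, sub_self] at h1
  exact h1

/-- For a fixed direction `u`, the sampled difference quotient at `X` may be replaced by that of
the objective. -/
theorem integral_inner_mul_quotient_sub_eq_zero (h : IsOracleCall m Pr F f L σ s w X)
    (hμ : 0 < μ) {φ : E n → E n} (hφ : Continuous φ) (hφ2 : MemLp (fun ω => φ (X ω)) 2 Pr)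
    (u : E n) :
    ∫ ω, ⟪φ (X ω), u⟫ * ((F (X ω + μ • u) (s ω) - F (X ω) (s ω)) / μ
      - (f (X ω + μ • u) - f (X ω)) / μ) ∂Pr = 0 := by
  -- Function values are only assumed integrable, but their error increments are square integrable,
  -- being controlled by the gradient error at `a` and the Taylor remainder of `F(·, s) - f`.
  have hZ2 : ∀ a, MemLp (fun ω => ((F (a + μ • u) (s ω) - f (a + μ • u))
      - (F a (s ω) - f a)) / μ) 2 Pr := fun a => by
    refine MemLp.mono' (g := fun ω => ‖stochGrad F a (s ω) - gradient f a‖ * ‖u‖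
        + μ * (L + L) / 2 * ‖u‖ ^ 2)
      (((h.memLp_error a).norm.mul_const _).add (memLp_const _)) ?_ ?_
    · exact ((((h.integrable_value _).sub (integrable_const _)).sub
        ((h.integrable_value a).sub (integrable_const _))).div_const μ).aestronglyMeasurable
    · filter_upwards [h.smooth] with ω hω
      have h1 := (hω.sub h.isC11).abs_quotient_le hμ a u
      rwa [hω.gradient_sub h.isC11] at h1
  have hZ : ∀ a, Pr[fun ω => ((F (a + μ • u) (s ω) - f (a + μ • u))
      - (F a (s ω) - f a)) / μ | m] =ᵐ[Pr] 0 := fun a => by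
    have j1 := (h.integrable_value (a + μ • u)).sub (integrable_const (f (a + μ • u)))
    have j2 := (h.integrable_value a).sub (integrable_const (f a))
    have h1 := condExp_smul (m := m) (μ := Pr) μ⁻¹ (fun ω => (F (a + μ • u) (s ω) - f (a + μ • u))
      - (F a (s ω) - f a))
    have h2 := condExp_sub j1 j2 m
    have h3 : (fun ω => ((F (a + μ • u) (s ω) - f (a + μ • u)) - (F a (s ω) - f a)) / μ)
        = μ⁻¹ • fun ω => (F (a + μ • u) (s ω) - f (a + μ • u)) - (F a (s ω) - f a) := by
      funext ω; simp [div_eq_inv_mul]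
    rw [h3]
    refine h1.trans ?_
    filter_upwards [h2, h.condExp_value_error (a + μ • u), h.condExp_value_error a]
      with ω h2 h4 h5
    have h6 : Pr[fun ω => (F (a + μ • u) (s ω) - f (a + μ • u)) - (F a (s ω) - f a) | m] ω = 0 := by
      refine Eq.trans h2 ?_
      rw [Pi.sub_apply]
      exact (congrArg₂ (· - ·) h4 h5).trans (sub_zero 0)
    rw [Pi.smul_apply, h6, smul_zero, Pi.zero_apply]
  have hlip : ∀ᵐ ω ∂Pr, ∀ a b, ‖((F (a + μ • u) (s ω) - f (a + μ • u)) - (F a (s ω) - f a)) / μ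
      - ((F (b + μ • u) (s ω) - f (b + μ • u)) - (F b (s ω) - f b)) / μ‖
      ≤ (L + L) * ‖μ • u‖ / μ * ‖a - b‖ := by
    filter_upwards [h.smooth] with ω hω a b
    have h1 := (hω.sub h.isC11).abs_increment_sub_le (μ • u) a b
    rw [← sub_div, norm_div, Real.norm_of_nonneg hμ.le, div_mul_eq_mul_div]
    gcongr
    exact h1
  have hc : Measurable[m] fun ω => ⟪φ (X ω), u⟫ :=
    (hφ.inner continuous_const).measurable.comp h.measurable_point
  have hc2 : MemLp (fun ω => ⟪φ (X ω), u⟫) 2 Pr := hφ2.inner_const u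
  have key := (integral_inner_comp_eq_zero h.le hZ2 hZ hlip h.measurable_point h.memLp_point
    hc.stronglyMeasurable hc2).2
  rw [← key]
  refine integral_congr_ae (Filter.Eventually.of_forall fun ω => ?_)
  simp only [RCLike.inner_apply, conj_trivial]
  ring

/-- The averaged inner product of the gradient-free estimator with a function of `X` depends on
the objective only. -/
theorem integral_inner_gradFree (h : IsOracleCall m Pr F f L σ s w X) (hμ : 0 < μ)
    {φ : E n → E n} (hφ : Continuous φ) (hφ2 : MemLp (fun ω => φ (X ω)) 2 Pr) :
    Integrable (fun ω => ∫ u, ⟪φ (X ω), u⟫ * ((f (X ω + μ • u) - f (X ω)) / μ)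
        ∂stdGaussian (E n)) Pr ∧
      ∫ ω, ⟪φ (X ω), gradFree F μ (X ω) (s ω) (w ω)⟫ ∂Pr
        = ∫ ω, ∫ u, ⟪φ (X ω), u⟫ * ((f (X ω + μ • u) - f (X ω)) / μ) ∂stdGaussian (E n) ∂Pr := by
  have hX : Measurable X := h.measurable_point.mono h.le le_rfl
  have hs := h.measurable_sample
  have hfc := h.isC11.continuous
  have hL := h.nonneg
  have hg : Measurable fun p : E n × (Ξ × E n) => ⟪φ p.2.2, gradFree F μ p.2.2 p.2.1 p.1⟫ :=
    (hφ.measurable.comp (measurable_snd.comp measurable_snd)).inner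
      (measurable_gradFree h.measurable μ)
  have i1 := (h.integrable_iff_prod hg).1 (hφ2.integrable_real_inner (h.memLp_gradFree hμ))
  have i2 : Integrable (fun z : E n × Ω => ⟪φ (X z.2), z.1⟫
      * ((f (X z.2 + μ • z.1) - f (X z.2)) / μ)) ((stdGaussian (E n)).prod Pr) := by
    have b1 := (integrable_norm_pow_stdGaussian (n := n) 2).mul_prod
      (hφ2.norm.integrable_mul h.memLp_gradient.norm)
    have b2 := ((integrable_norm_pow_stdGaussian (n := n) 3).const_mul (μ * L / 2)).mul_prod
      (hφ2.norm.integrable one_le_two)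
    have hm : Measurable fun z : E n × Ω => ⟪φ (X z.2), z.1⟫
        * ((f (X z.2 + μ • z.1) - f (X z.2)) / μ) := by
      have : Continuous fun z : E n × E n => ⟪φ z.2, z.1⟫ * ((f (z.2 + μ • z.1) - f z.2) / μ) := by
        fun_prop
      exact this.measurable.comp (f := fun z : E n × Ω => (z.1, X z.2)) (by fun_prop)
    refine (b1.add b2).mono' hm.aestronglyMeasurable (Filter.Eventually.of_forall fun z => ?_)
    rw [norm_mul, Real.norm_eq_abs, Real.norm_eq_abs]
    calc |⟪φ (X z.2), z.1⟫| * |(f (X z.2 + μ • z.1) - f (X z.2)) / μ|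
        ≤ (‖φ (X z.2)‖ * ‖z.1‖) * (‖gradient f (X z.2)‖ * ‖z.1‖ + μ * L / 2 * ‖z.1‖ ^ 2) :=
          mul_le_mul (abs_real_inner_le_norm _ _) (h.isC11.abs_quotient_le hμ _ _) (abs_nonneg _)
            (by positivity)
      _ = _ := by simp only [Pi.add_apply, Pi.mul_apply]; ring
  refine ⟨i2.integral_prod_right, ?_⟩
  rw [h.integral_eq_prod hg, ← integral_prod_symm _ i2, ← sub_eq_zero, ← integral_sub i1 i2]
  -- The sample is integrated first, for a fixed direction `u`, because unbiasedness concerns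
  -- deterministic displacements.
  refine (integral_prod _ (i1.sub i2)).trans ?_
  refine integral_eq_zero_of_ae (Filter.Eventually.of_forall fun u => ?_)
  simp only [Pi.sub_apply, Pi.zero_apply]
  rw [← h.integral_inner_mul_quotient_sub_eq_zero hμ hφ hφ2 u]
  refine integral_congr_ae (Filter.Eventually.of_forall fun ω => ?_)
  simp only [gradFree, real_inner_smul_right]
  ring

end IsOracleCall

/-! ### One-step inequalities -/

namespace IsOracleCall

variable {n : ℕ} {Ω : Type u} {Ξ : Type v} {m m0 : MeasurableSpace Ω} [MeasurableSpace Ξ]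
  {Pr : Measure[m0] Ω} [IsProbabilityMeasure Pr] {F : E n → Ξ → ℝ} {f : E n → ℝ} {L σ μ γ : ℝ}
  {s : Ω → Ξ} {w X : Ω → E n}

theorem memLp_update (h : IsOracleCall m Pr F f L σ s w X) (hμ : 0 < μ) (γ : ℝ) :
    MemLp (fun ω => X ω - γ • gradFree F μ (X ω) (s ω) (w ω)) 2 Pr :=
  h.memLp_point.sub ((h.memLp_gradFree hμ).const_smul γ)

theorem integrable_sq_norm_gradient (h : IsOracleCall m Pr F f L σ s w X) :
    Integrable (fun ω => ‖gradient f (X ω)‖ ^ 2) Pr :=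
  h.memLp_gradient.integrable_norm_pow two_ne_zero

end IsOracleCall

theorem IsC11.integrable_comp {n : ℕ} {Ω : Type u} [MeasurableSpace Ω] {Pr : Measure Ω}
    [IsProbabilityMeasure Pr] {f : E n → ℝ} {L : ℝ} (hf : IsC11 L f) {Y : Ω → E n}
    (hY : MemLp Y 2 Pr) : Integrable (fun ω => f (Y ω)) Pr := by
  have h1 : Integrable (fun ω => ‖Y ω‖) Pr := (hY.integrable one_le_two).norm
  have h2 : Integrable (fun ω => ‖Y ω‖ ^ 2) Pr := hY.integrable_norm_pow two_ne_zero
  exact (((integrable_const |f 0|).add (h1.const_mul ‖gradient f 0‖)).add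
    (h2.const_mul (L / 2))).mono'
    (hf.continuous.comp_aestronglyMeasurable hY.aestronglyMeasurable)
    (Filter.Eventually.of_forall fun ω => hf.abs_apply_le (Y ω))

namespace IsOracleCall

variable {n : ℕ} {Ω : Type u} {Ξ : Type v} {m m0 : MeasurableSpace Ω} [MeasurableSpace Ξ]
  {Pr : Measure[m0] Ω} [IsProbabilityMeasure Pr] {F : E n → Ξ → ℝ} {f : E n → ℝ} {L σ μ γ : ℝ}
  {s : Ω → Ξ} {w X : Ω → E n}

/-- Expected decrease of the objective in one step. -/
theorem integral_objective_update_le (h : IsOracleCall m Pr F f L σ s w X) (hμ : 0 < μ)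
    (hγ : 0 ≤ γ) :
    ∫ ω, f (X ω - γ • gradFree F μ (X ω) (s ω) (w ω)) ∂Pr
        + (γ / 2 - L * (n + 4) * γ ^ 2) * ∫ ω, ‖gradient f (X ω)‖ ^ 2 ∂Pr
      ≤ ∫ ω, f (X ω) ∂Pr + (γ * (μ ^ 2 * L ^ 2 / 8 * (n + 4) ^ 2)
        + L * γ ^ 2 / 2 * (2 * (n + 4) * σ ^ 2 + μ ^ 2 * L ^ 2 / 2 * (n + 4) ^ 3)) := by
  have hL := h.nonneg
  set G := fun ω => gradFree F μ (X ω) (s ω) (w ω) with hG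
  obtain ⟨i1, e1⟩ := h.integrable_sq_norm_gradFree hμ
  obtain ⟨i2, e2⟩ := h.integral_inner_gradFree hμ h.isC11.continuous_gradient h.memLp_gradient
  have i3 := h.integrable_sq_norm_gradient
  have i4 := h.isC11.integrable_comp h.memLp_point
  have i5 := h.isC11.integrable_comp (h.memLp_update hμ γ)
  have i6 : Integrable (fun ω => ⟪gradient f (X ω), G ω⟫) Pr :=
    h.memLp_gradient.integrable_real_inner (h.memLp_gradFree hμ)
  have i7 : Integrable (fun ω => f (X ω) - γ * ⟪gradient f (X ω), G ω⟫) Pr :=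
    i4.sub (i6.const_mul γ)
  have hpt : ∀ ω, f (X ω - γ • G ω)
      ≤ f (X ω) - γ * ⟪gradient f (X ω), G ω⟫ + L * γ ^ 2 / 2 * ‖G ω‖ ^ 2 := fun ω => by
    have h1 := (abs_le.1 (h.isC11.abs_sub_sub_inner_le (X ω) (-(γ • G ω)))).2
    rw [inner_neg_right, real_inner_smul_right, norm_neg, norm_smul, mul_pow, Real.norm_eq_abs,
      sq_abs, ← sub_eq_add_neg] at h1
    linarith
  have h1 := integral_mono i5 (i7.add (i1.const_mul (L * γ ^ 2 / 2))) hpt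
  have h2 : ∫ ω, (f (X ω) - γ * ⟪gradient f (X ω), G ω⟫ + L * γ ^ 2 / 2 * ‖G ω‖ ^ 2) ∂Pr
      = ∫ ω, f (X ω) ∂Pr - γ * ∫ ω, ⟪gradient f (X ω), G ω⟫ ∂Pr
        + L * γ ^ 2 / 2 * ∫ ω, ‖G ω‖ ^ 2 ∂Pr := by
    rw [integral_add i7 (i1.const_mul _), integral_sub i4 (i6.const_mul γ), integral_const_mul,
      integral_const_mul]
  have h3 : (∫ ω, ‖gradient f (X ω)‖ ^ 2 ∂Pr) / 2 - μ ^ 2 * L ^ 2 / 8 * (n + 4) ^ 2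
      ≤ ∫ ω, ⟪gradient f (X ω), G ω⟫ ∂Pr := by
    rw [e2]
    have := integral_mono ((i3.div_const 2).sub (integrable_const
      (μ ^ 2 * L ^ 2 / 8 * ((n : ℝ) + 4) ^ 2))) i2
      (fun ω => h.isC11.le_integral_inner_gradient_mul_quotient hμ (X ω))
    refine le_trans (le_of_eq ?_) this
    rw [integral_sub' (i3.div_const 2) (integrable_const _), integral_div]
    simp
  -- The descent term contributes `γ/2` and the second moment `(Lγ²/2)·2(n+4)` to the coefficient of
  -- `E‖∇f(X)‖²`; the difference is half the numerator of `P_R`.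
  have h4 := mul_le_mul_of_nonneg_left h3 hγ
  have h5 := mul_le_mul_of_nonneg_left e1 (by positivity : 0 ≤ L * γ ^ 2 / 2)
  have h6 : ∫ ω, f (X ω - γ • G ω) ∂Pr ≤ ∫ ω, f (X ω) ∂Pr
      - γ * ∫ ω, ⟪gradient f (X ω), G ω⟫ ∂Pr + L * γ ^ 2 / 2 * ∫ ω, ‖G ω‖ ^ 2 ∂Pr :=
    h2 ▸ h1
  nlinarith

/-- Expected decrease of the squared distance to a minimizer in one step. -/
theorem integral_sq_dist_update_le (h : IsOracleCall m Pr F f L σ s w X) (hL : 0 < L) (hμ : 0 < μ)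
    (hγ : 0 ≤ γ) (hc : ConvexOn ℝ Set.univ f) {y : E n} (hy : IsMinOn f Set.univ y) :
    ∫ ω, ‖X ω - γ • gradFree F μ (X ω) (s ω) (w ω) - y‖ ^ 2 ∂Pr
        + 2 * (γ - 2 * L * (n + 4) * γ ^ 2) * ∫ ω, (f (X ω) - f y) ∂Pr
      ≤ ∫ ω, ‖X ω - y‖ ^ 2 ∂Pr + (γ * (μ ^ 2 * L * n)
        + γ ^ 2 * (2 * (n + 4) * σ ^ 2 + μ ^ 2 * L ^ 2 / 2 * (n + 4) ^ 3)) := by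
  set G := fun ω => gradFree F μ (X ω) (s ω) (w ω) with hG
  obtain ⟨i1, e1⟩ := h.integrable_sq_norm_gradFree hμ
  have hXy : MemLp (fun ω => X ω - y) 2 Pr := h.memLp_point.sub (memLp_const y)
  obtain ⟨i2, e2⟩ := h.integral_inner_gradFree hμ (φ := fun x => x - y) (by fun_prop) hXy
  have i3 := h.integrable_sq_norm_gradient
  have i4 : Integrable (fun ω => f (X ω) - f y) Pr :=
    (h.isC11.integrable_comp h.memLp_point).sub (integrable_const _)
  have i5 : Integrable (fun ω => ‖X ω - y‖ ^ 2) Pr := hXy.integrable_norm_pow two_ne_zero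
  have i6 : Integrable (fun ω => ⟪X ω - y, G ω⟫) Pr :=
    hXy.integrable_real_inner (h.memLp_gradFree hμ)
  have i7 : Integrable (fun ω => ‖X ω - y‖ ^ 2 - 2 * γ * ⟪X ω - y, G ω⟫) Pr :=
    i5.sub (i6.const_mul (2 * γ))
  have hpt : ∀ ω, ‖X ω - γ • G ω - y‖ ^ 2
      = ‖X ω - y‖ ^ 2 - 2 * γ * ⟪X ω - y, G ω⟫ + γ ^ 2 * ‖G ω‖ ^ 2 := fun ω => by
    rw [sub_right_comm, norm_sub_sq_real, real_inner_smul_right, norm_smul, mul_pow,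
      Real.norm_eq_abs, sq_abs]
    ring
  have h1 : ∫ ω, ‖X ω - γ • G ω - y‖ ^ 2 ∂Pr = ∫ ω, ‖X ω - y‖ ^ 2 ∂Pr
      - 2 * γ * ∫ ω, ⟪X ω - y, G ω⟫ ∂Pr + γ ^ 2 * ∫ ω, ‖G ω‖ ^ 2 ∂Pr := by
    simp only [hpt]
    rw [integral_add i7 (i1.const_mul _), integral_sub i5 (i6.const_mul _), integral_const_mul,
      integral_const_mul]
  have h3 : ∫ ω, (f (X ω) - f y) ∂Pr - μ ^ 2 * L / 2 * n ≤ ∫ ω, ⟪X ω - y, G ω⟫ ∂Pr := by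
    rw [e2]
    have := integral_mono (i4.sub (integrable_const (μ ^ 2 * L / 2 * (n : ℝ)))) i2
      (fun ω => h.isC11.le_integral_inner_sub_mul_quotient hL.le hμ hc hy (X ω))
    refine le_trans (le_of_eq ?_) this
    rw [integral_sub' i4 (integrable_const _)]
    simp
  -- The squared gradient in the second moment is absorbed into the objective gap. This costs
  -- `γ²·2(n+4)·2L` of the coefficient `2γ` and leaves twice the numerator of `P_R`.
  have h4 : ∫ ω, ‖gradient f (X ω)‖ ^ 2 ∂Pr ≤ 2 * L * ∫ ω, (f (X ω) - f y) ∂Pr := by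
    rw [← integral_const_mul]
    exact integral_mono i3 (i4.const_mul _) fun ω =>
      h.isC11.sq_norm_gradient_le hL (isMinOn_univ_iff.1 hy) (X ω)
  have h5 := mul_le_mul_of_nonneg_left h3 hγ
  have h6 := mul_le_mul_of_nonneg_left e1 (sq_nonneg γ)
  have h7 := mul_le_mul_of_nonneg_left h4 (by positivity : 0 ≤ γ ^ 2 * (2 * ((n : ℝ) + 4)))
  have h8 : ∫ ω, ‖X ω - γ • G ω - y‖ ^ 2 ∂Pr ≤ _ := h1.le
  nlinarith

end IsOracleCall

/-! ### Measurability with respect to the history -/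

section History

variable {n : ℕ} {Ω : Type u} {Ξ : Type v} [MeasurableSpace Ξ]
  {ξ : ℕ → Ω → Ξ} {w : ℕ → Ω → E n}

theorem measurable_history [MeasurableSpace Ω] (hξ : ∀ k, 1 ≤ k → Measurable (ξ k))
    (hw : ∀ k, 1 ≤ k → Measurable (w k)) (k : ℕ) : Measurable (history ξ w k) :=
  measurable_pi_lambda _ fun i =>
    (hξ i (Finset.mem_Ico.1 i.2).1).prodMk (hw i (Finset.mem_Ico.1 i.2).1)

theorem historySigma_mono {j k : ℕ} (hjk : j ≤ k) : historySigma ξ w j ≤ historySigma ξ w k := by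
  have h1 : history ξ w j
      = (fun (z : Ico 1 k → Ξ × E n) (i : Ico 1 j) => z ⟨i, Ico_subset_Ico_right hjk i.2⟩)
        ∘ history ξ w k := rfl
  rw [historySigma, h1, ← MeasurableSpace.comap_comp]
  refine MeasurableSpace.comap_mono (Measurable.comap_le ?_)
  exact measurable_pi_lambda _ fun i => measurable_pi_apply _

theorem measurable_sample_historySigma {k : ℕ} (hk : 1 ≤ k) :
    Measurable[historySigma ξ w (k + 1)] fun ω => (ξ k ω, w k ω) :=
  (measurable_pi_apply (X := fun _ : Ico 1 (k + 1) => Ξ × E n)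
    ⟨k, Finset.mem_Ico.2 ⟨hk, k.lt_succ_self⟩⟩).comp (comap_measurable (history ξ w (k + 1)))

/-- The point `x_{k+1}` uses the samples `1, …, k`, which are exactly those in the history with
index `k + 1`. -/
theorem measurable_rsgfIterate {F : E n → Ξ → ℝ} (hF : Measurable (Function.uncurry F))
    (γ : ℕ → ℝ) (μ : ℝ) (x₁ : E n) (k : ℕ) :
    Measurable[historySigma ξ w (k + 1)] (rsgfIterate F γ μ x₁ ξ w (k + 1)) := by
  induction k with
  | zero => exact measurable_const
  | succ k ih =>
    have h1 : Measurable[historySigma ξ w (k + 1 + 1)] (rsgfIterate F γ μ x₁ ξ w (k + 1)) :=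
      ih.mono (historySigma_mono (Nat.le_succ _)) le_rfl
    have h2 := measurable_sample_historySigma (ξ := ξ) (w := w) (Nat.le_add_left 1 k)
    have h3 := (IsOracleCall.measurable_gradFree hF μ).comp (h2.snd.prodMk (h2.fst.prodMk h1))
    exact h1.sub (h3.const_smul (γ (k + 1)))

end History

/-! ### The run as a sequence of oracle calls -/

namespace IsRSGFRun

variable {n : ℕ} {Ω : Type u} {Ξ : Type v} [MeasurableSpace Ω] [MeasurableSpace Ξ]
  {Pr : Measure Ω} {P : Measure Ξ} {F : E n → Ξ → ℝ} {ξ : ℕ → Ω → Ξ} {w : ℕ → Ω → E n} {R : Ω → ℕ} {L σ Dt : ℝ} {γ : ℕ → ℝ}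
  {μ : ℝ} {N : ℕ}

theorem indepFun_count_iterate (h : IsRSGFRun Pr P F ξ w R L σ Dt γ μ N) (x₁ : E n) {k : ℕ}
    (hk : k ∈ Icc 1 N) : IndepFun R (rsgfIterate F γ μ x₁ ξ w k) Pr := by
  obtain ⟨h1, h2⟩ := Finset.mem_Icc.1 hk
  obtain ⟨j, rfl⟩ := Nat.exists_eq_add_of_le' h1
  have h3 := h.sampling.indep_count
  rw [IndepFun_iff_Indep] at h3 ⊢
  refine indep_of_indep_of_le_right h3 ?_
  rw [← measurable_iff_comap_le]
  exact (measurable_rsgfIterate h.program.measurable γ μ x₁ j).mono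
    (historySigma_mono (by omega)) le_rfl

variable [IsProbabilityMeasure P]

/-- Square integrability of the iterate is left as a hypothesis so that the induction can use it: a
call at `x_k` in `L²` yields an estimator in `L²`, hence `x_{k+1}` in `L²`. -/
theorem isOracleCall_of_memLp (h : IsRSGFRun Pr P F ξ w R L σ Dt γ μ N) (hL : 0 ≤ L) (x₁ : E n)
    (k : ℕ) (hX : MemLp (rsgfIterate F γ μ x₁ ξ w (k + 1)) 2 Pr) :
    IsOracleCall (historySigma ξ w (k + 1)) Pr F (objective P F) L σ (ξ (k + 1)) (w (k + 1))
      (rsgfIterate F γ μ x₁ ξ w (k + 1)) := by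
  have hk : 1 ≤ k + 1 := Nat.le_add_left 1 k
  have hm := measurable_rsgfIterate (ξ := ξ) (w := w) h.program.measurable γ μ x₁ k
  refine
    { le := (measurable_history h.sampling.measurable_noise h.sampling.measurable_gauss _).comap_le
      nonneg := hL
      measurable := h.program.measurable
      smooth := h.sampling.smooth _ hk
      isC11 := h.program.isC11_objective
      measurable_sample := h.sampling.measurable_noise _ hk
      measurable_dir := h.sampling.measurable_gauss _ hk
      measurable_point := hm
      memLp_point := hX
      integrable_value := h.a3.integrable _ hk
      condExp_value := h.a3.unbiased _ hk
      integrable_grad := h.a1.integrable _ hk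
      condExp_grad := h.a1.unbiased _ hk
      integrable_sq := h.a1.sq_integrable _ hk
      condExp_sq_le := h.a1.variance_le _ hk
      map_dir := h.sampling.gauss _ hk
      indep := ?_ }
  have h1 := h.sampling.indep_gauss _ hk
  rw [IndepFun_iff_Indep] at h1 ⊢
  refine indep_of_indep_of_le_right h1 ?_
  rw [← measurable_iff_comap_le]
  have h2 := comap_measurable (m := inferInstance)
    (fun ω => (ξ (k + 1) ω, history ξ w (k + 1) ω))
  refine h2.fst.prodMk (hm.mono ?_ le_rfl)
  exact h2.snd.comap_le

variable [IsProbabilityMeasure Pr]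

theorem memLp_iterate (h : IsRSGFRun Pr P F ξ w R L σ Dt γ μ N) (hL : 0 ≤ L) (x₁ : E n) (k : ℕ) :
    MemLp (rsgfIterate F γ μ x₁ ξ w (k + 1)) 2 Pr := by
  induction k with
  | zero => exact memLp_const x₁
  | succ k ih => exact (h.isOracleCall_of_memLp hL x₁ k ih).memLp_update h.mu_pos _

theorem isOracleCall (h : IsRSGFRun Pr P F ξ w R L σ Dt γ μ N) (hL : 0 ≤ L) (x₁ : E n) (k : ℕ) :
    IsOracleCall (historySigma ξ w (k + 1)) Pr F (objective P F) L σ (ξ (k + 1)) (w (k + 1))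
      (rsgfIterate F γ μ x₁ ξ w (k + 1)) :=
  h.isOracleCall_of_memLp hL x₁ k (h.memLp_iterate hL x₁ k)

end IsRSGFRun

/-! ### Telescoping and the random index -/

theorem mul_sum_Icc_le_of_step {a b : ℕ → ℝ} {α e : ℝ} (N : ℕ)
    (h : ∀ k ∈ Icc 1 N, a (k + 1) + α * b k ≤ a k + e) :
    a (N + 1) + α * ∑ k ∈ Icc 1 N, b k ≤ a 1 + N * e := by
  induction N with
  | zero => simp
  | succ N ih =>
    have h1 := ih fun k hk => h k (Icc_subset_Icc_right N.le_succ hk)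
    have h2 := h (N + 1) (by simp)
    rw [Finset.sum_Icc_succ_top (by omega)]
    push_cast
    linarith

/-- The expectation at a uniformly distributed independent index is the average. -/
theorem integral_comp_uniform_index {n : ℕ} {Ω : Type u} [MeasurableSpace Ω] {Pr : Measure Ω}
    [IsProbabilityMeasure Pr] {R : Ω → ℕ} (hR : Measurable R) {N : ℕ} (hN : 1 ≤ N)
    (hp : ∀ k ∈ Icc 1 N, Pr.real {ω | R ω = k} = 1 / N) {X : ℕ → Ω → E n}
    (hi : ∀ k ∈ Icc 1 N, IndepFun R (X k) Pr) {φ : E n → ℝ} (hφ : Measurable φ)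
    (hX : ∀ k ∈ Icc 1 N, Integrable (fun ω => φ (X k ω)) Pr) :
    Integrable (fun ω => φ (X (R ω) ω)) Pr ∧
      ∫ ω, φ (X (R ω) ω) ∂Pr = 1 / N * ∑ k ∈ Icc 1 N, ∫ ω, φ (X k ω) ∂Pr := by
  have hmeas : ∀ k, MeasurableSet {ω | R ω = k} := fun k => hR (measurableSet_singleton k)
  have hNpos : (0 : ℝ) < N := by exact_mod_cast hN
  -- The masses on `{1, …, N}` already add up to `1`, so `R` has no mass elsewhere.
  have hmem : ∀ᵐ ω ∂Pr, R ω ∈ Icc 1 N := by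
    have h1 : {ω | R ω ∈ Icc 1 N} = ⋃ k ∈ Icc 1 N, {ω | R ω = k} := by ext ω; simp
    have h2 : Pr.real {ω | R ω ∈ Icc 1 N} = 1 := by
      rw [h1, measureReal_biUnion_finset (fun i _ j _ hij => by
        rw [Function.onFun, Set.disjoint_left]
        intro ω h3 h4
        exact hij (h3.symm.trans h4)) (fun k _ => hmeas k), Finset.sum_congr rfl hp]
      simp [hNpos.ne']
    have h3 : MeasurableSet {ω | R ω ∈ Icc 1 N} := hR (Finset.measurableSet _)
    rw [ae_iff]
    exact (prob_compl_eq_zero_iff h3).2 (by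
      rw [← ENNReal.toReal_eq_one_iff]; exact h2)
  let ind : ℕ → ℕ → ℝ := fun k r => if r = k then 1 else 0
  have hind : ∀ k, Integrable (fun ω => ind k (R ω)) Pr ∧ ∫ ω, ind k (R ω) ∂Pr
      = Pr.real {ω | R ω = k} := fun k => by
    have h1 : (fun ω => ind k (R ω)) = {ω | R ω = k}.indicator fun _ => (1 : ℝ) := by
      funext ω; simp [ind, Set.indicator_apply]
    rw [h1]
    refine ⟨(integrable_const _).indicator (hmeas k), ?_⟩
    rw [integral_indicator (hmeas k)]
    simp
  have hind2 : ∀ k ∈ Icc 1 N, IndepFun (fun ω => ind k (R ω)) (fun ω => φ (X k ω)) Pr :=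
    fun k hk => (hi k hk).comp (measurable_of_countable (ind k)) hφ
  have hint : ∀ k ∈ Icc 1 N, Integrable (fun ω => ind k (R ω) * φ (X k ω)) Pr := fun k hk =>
    (hind2 k hk).integrable_mul (hind k).1 (hX k hk)
  have heq : (fun ω => φ (X (R ω) ω)) =ᵐ[Pr] fun ω => ∑ k ∈ Icc 1 N, ind k (R ω) * φ (X k ω) := by
    filter_upwards [hmem] with ω hω
    rw [Finset.sum_eq_single_of_mem _ hω]
    · simp [ind]
    · intro k _ hk
      simp [ind, hk.symm]
  refine ⟨(integrable_finsetSum _ hint).congr heq.symm, ?_⟩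
  rw [integral_congr_ae heq, integral_finsetSum _ hint, Finset.mul_sum]
  refine Finset.sum_congr rfl fun k hk => ?_
  rw [(hind2 k hk).integral_fun_mul_eq_mul_integral (hind k).1.aestronglyMeasurable
    (hX k hk).aestronglyMeasurable, (hind k).2, hp k hk]

/-! ### Stepsize bounds and the arithmetic of the rates -/

section Step

variable {n : ℕ} {L σ Dt : ℝ} {N : ℕ}

theorem rsgfStep_pos (hL : 0 < L) (hσ : 0 ≤ σ) (hDt : 0 < Dt) (hN : 1 ≤ N) :
    0 < rsgfStep n L σ Dt N := by
  have hN' : (0 : ℝ) < N := by exact_mod_cast hN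
  unfold rsgfStep
  split_ifs with h
  · positivity
  · have := lt_of_le_of_ne hσ (Ne.symm h)
    exact mul_pos (by positivity) (lt_min (by positivity) (by positivity))

/-- From the first entry of the minimum. It makes `2L(n+4)γ²` at most `γ/2`, so half of the useful
coefficient survives. -/
theorem rsgfStep_mul_le (hL : 0 < L) : 4 * L * (n + 4) * rsgfStep n L σ Dt N ≤ 1 := by
  have hs : 0 < √(n + 4 : ℝ) := by positivity
  have h1 : rsgfStep n L σ Dt N ≤ 1 / √(n + 4 : ℝ) * (1 / (4 * L * √(n + 4 : ℝ))) := by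
    unfold rsgfStep
    gcongr
    split_ifs
    exacts [le_rfl, min_le_left _ _]
  have h2 : 1 / √(n + 4 : ℝ) * (1 / (4 * L * √(n + 4 : ℝ))) = 1 / (4 * L * (n + 4)) := by
    have hM : √(n + 4 : ℝ) * √(n + 4 : ℝ) = n + 4 := Real.mul_self_sqrt (by positivity)
    rw [← hM]
    simp only [Real.sqrt_mul_self hs.le]
    field_simp
  rw [h2, le_div_iff₀ (by positivity)] at h1
  linarith

theorem sq_mul_rsgfStep_le (hσ : 0 ≤ σ) (hN : 1 ≤ N) :
    σ ^ 2 * (n + 4) * rsgfStep n L σ Dt N ≤ σ * √(n + 4) / √N * Dt := by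
  have hN' : (0 : ℝ) < N := by exact_mod_cast hN
  rcases hσ.eq_or_lt with rfl | h
  · simp
  have h1 : rsgfStep n L σ Dt N ≤ 1 / √(n + 4 : ℝ) * (Dt / (σ * √N)) := by
    unfold rsgfStep
    rw [if_neg h.ne']
    gcongr
    exact min_le_right _ _
  have hM : (n + 4 : ℝ) = √(n + 4 : ℝ) * √(n + 4 : ℝ) :=
    (Real.mul_self_sqrt (by positivity)).symm
  calc σ ^ 2 * (n + 4) * rsgfStep n L σ Dt N
      ≤ σ ^ 2 * (n + 4) * (1 / √(n + 4 : ℝ) * (Dt / (σ * √N))) := by gcongr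
    _ = σ ^ 2 * (√(n + 4 : ℝ) * √(n + 4 : ℝ)) * (1 / √(n + 4 : ℝ) * (Dt / (σ * √N))) := by
        rw [← hM]
    _ = _ := by field_simp

/-- The reciprocal of a minimum is the maximum of the reciprocals, hence at most their sum. -/
theorem one_div_rsgfStep_le (hL : 0 < L) (hσ : 0 ≤ σ) (hDt : 0 < Dt) (hN : 1 ≤ N) :
    1 / rsgfStep n L σ Dt N ≤ 4 * L * (n + 4) + σ * √(n + 4) * √N / Dt := by
  have hN' : (0 : ℝ) < N := by exact_mod_cast hN
  have hM : (n + 4 : ℝ) = √(n + 4 : ℝ) * √(n + 4 : ℝ) :=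
    (Real.mul_self_sqrt (by positivity)).symm
  have hs : 0 < √(n + 4 : ℝ) := by positivity
  have h1 : 1 / (1 / √(n + 4 : ℝ) * (1 / (4 * L * √(n + 4 : ℝ)))) = 4 * L * (n + 4) := by
    rw [hM]
    simp only [Real.sqrt_mul_self hs.le]
    field_simp
  have h2 : 0 ≤ σ * √(n + 4) * √N / Dt := by positivity
  have h3 : 0 ≤ 4 * L * (n + 4) := by positivity
  unfold rsgfStep
  split_ifs with h
  · rw [h1]; linarith
  · have hσ' := lt_of_le_of_ne hσ (Ne.symm h)
    rcases min_choice (1 / (4 * L * √(n + 4 : ℝ))) (Dt / (σ * √N)) with hc | hc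
    · rw [hc, h1]; linarith
    · rw [hc]
      have h4 : 1 / (1 / √(n + 4 : ℝ) * (Dt / (σ * √N))) = σ * √(n + 4) * √N / Dt := by
        field_simp
      rw [h4]; linarith

theorem rsgfPmf_eq {γ : ℕ → ℝ} (hL : 0 < L) (hσ : 0 ≤ σ) (hDt : 0 < Dt) (hN : 1 ≤ N)
    (hγ : ∀ k ∈ Icc 1 N, γ k = rsgfStep n L σ Dt N) {k : ℕ} (hk : k ∈ Icc 1 N) :
    rsgfPmf n L γ N k = 1 / N := by
  have h1 := rsgfStep_pos (n := n) hL hσ hDt hN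
  have h2 := rsgfStep_mul_le (n := n) (σ := σ) (Dt := Dt) (N := N) hL
  have hN' : (0 : ℝ) < N := by exact_mod_cast hN
  set c := rsgfStep n L σ Dt N
  have h3 : 0 < c - 2 * L * (n + 4) * c ^ 2 := by nlinarith
  have h4 : ∑ j ∈ Icc 1 N, (γ j - 2 * L * (n + 4) * γ j ^ 2) = N * (c - 2 * L * (n + 4) * c ^ 2) := by
    rw [Finset.sum_congr rfl fun j hj => by rw [hγ j hj]]
    rw [Finset.sum_const, Nat.card_Icc, Nat.add_sub_cancel, nsmul_eq_mul]
  rw [rsgfPmf, h4, hγ k hk, mul_comm (N : ℝ), ← div_div, div_self h3.ne']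

end Step

/-- Here `M = n + 4`, `c` is the stepsize and `S` the sum of the expected squared gradients. By `h1`
their coefficient is at least `c/4`; division by `LNc/4` leaves `2D²/(Nc)`, the noise `4σ²Mc` and
smoothing terms of total at most `(3/8)LD²/N`. The first costs `8` of the constant `12`, and the
smoothing fits in the remaining `4`. -/
theorem gradient_rate_of_sum_le {L σ Dt c M N D μ S : ℝ} (hL : 0 < L) (hσ : 0 ≤ σ) (hDt : 0 < Dt)
    (hc : 0 < c) (hM : 4 ≤ M) (hN : 1 ≤ N) (hS : 0 ≤ S) (h1 : 4 * L * M * c ≤ 1)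
    (h2 : σ ^ 2 * M * c ≤ σ * √M / √N * Dt) (h3 : 1 / c ≤ 4 * L * M + σ * √M * √N / Dt)
    (hμ : μ ^ 2 * (M ^ 2 * (2 * N)) ≤ D ^ 2)
    (hsum : (c / 2 - L * M * c ^ 2) * S ≤ L * D ^ 2 / 2 + N * (c * (μ ^ 2 * L ^ 2 / 8 * M ^ 2)
      + L * c ^ 2 / 2 * (2 * M * σ ^ 2 + μ ^ 2 * L ^ 2 / 2 * M ^ 3))) :
    1 / L * (1 / N * S) ≤ 12 * M * L * D ^ 2 / N + 4 * σ * √M / √N * (Dt + D ^ 2 / Dt) := by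
  have hN0 : 0 < N := by linarith
  have hM0 : 0 < M := by linarith
  have hr : √N / N = 1 / √N := by rw [Real.sqrt_div_self']
  have e1 : c / 4 * S ≤ (c / 2 - L * M * c ^ 2) * S := by
    apply mul_le_mul_of_nonneg_right _ hS
    nlinarith
  have e2 : 1 / L * (1 / N * S) = 4 / (L * N * c) * (c / 4 * S) := by field_simp
  have e3 : 4 / (L * N * c) * (L * D ^ 2 / 2 + N * (c * (μ ^ 2 * L ^ 2 / 8 * M ^ 2)
      + L * c ^ 2 / 2 * (2 * M * σ ^ 2 + μ ^ 2 * L ^ 2 / 2 * M ^ 3)))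
      = 2 * D ^ 2 / N * (1 / c) + 4 * (σ ^ 2 * M * c) + μ ^ 2 * (M ^ 2 * (2 * N)) * (L / (4 * N))
        + μ ^ 2 * (M ^ 2 * (2 * N)) * (4 * L * M * c) * (L / (8 * N)) := by
    field_simp; ring
  have e4 : 2 * D ^ 2 / N * (1 / c) ≤ 8 * M * L * D ^ 2 / N + 2 * σ * √M / √N * (D ^ 2 / Dt) := by
    calc 2 * D ^ 2 / N * (1 / c) ≤ 2 * D ^ 2 / N * (4 * L * M + σ * √M * √N / Dt) := by gcongr
      _ = 8 * M * L * D ^ 2 / N + 2 * σ * √M * (√N / N) * (D ^ 2 / Dt) := by field_simp; ring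
      _ = _ := by rw [hr]; ring
  have e5 : μ ^ 2 * (M ^ 2 * (2 * N)) * (L / (4 * N)) ≤ D ^ 2 * (L / (4 * N)) := by gcongr
  have e6 : μ ^ 2 * (M ^ 2 * (2 * N)) * (4 * L * M * c) * (L / (8 * N))
      ≤ D ^ 2 * 1 * (L / (8 * N)) := by gcongr
  have e7 : D ^ 2 * (L / (4 * N)) + D ^ 2 * 1 * (L / (8 * N)) ≤ 4 * M * L * D ^ 2 / N := by
    have : D ^ 2 * (L / (4 * N)) + D ^ 2 * 1 * (L / (8 * N)) = 3 / 8 * (L * D ^ 2 / N) := by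
      field_simp; ring
    rw [this, show 4 * M * L * D ^ 2 / N = 4 * M * (L * D ^ 2 / N) by ring]
    gcongr
    linarith
  have e8 : 0 ≤ 2 * σ * √M / √N * (D ^ 2 / Dt) := by positivity
  calc 1 / L * (1 / N * S) ≤ 4 / (L * N * c) * (L * D ^ 2 / 2 + N * (c * (μ ^ 2 * L ^ 2 / 8 * M ^ 2)
      + L * c ^ 2 / 2 * (2 * M * σ ^ 2 + μ ^ 2 * L ^ 2 / 2 * M ^ 3))) := by
        rw [e2]; gcongr; exact e1.trans hsum
    _ ≤ 8 * M * L * D ^ 2 / N + 2 * σ * √M / √N * (D ^ 2 / Dt) + 4 * (σ * √M / √N * Dt)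
        + 4 * M * L * D ^ 2 / N + 2 * σ * √M / √N * (D ^ 2 / Dt) := by rw [e3]; linarith
    _ = _ := by ring

/-- As for the gradient, with coefficient at least `c`: the term `D²/(Nc)` costs `4` of the constant
`5`, and the smoothing total `(9/16)LD²/N` fits in the last unit. -/
theorem objective_rate_of_sum_le {L σ Dt c n M N D μ S : ℝ} (hL : 0 < L) (hσ : 0 ≤ σ) (hDt : 0 < Dt)
    (hc : 0 < c) (hM : 4 ≤ M) (hn : n ≤ M)
    (hN : 1 ≤ N) (hS : 0 ≤ S) (h1 : 4 * L * M * c ≤ 1)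
    (h2 : σ ^ 2 * M * c ≤ σ * √M / √N * Dt)
    (h3 : 1 / c ≤ 4 * L * M + σ * √M * √N / Dt)
    (hμ : μ ^ 2 * (M ^ 2 * (2 * N)) ≤ D ^ 2)
    (hsum : 2 * (c - 2 * L * M * c ^ 2) * S ≤ D ^ 2 + N * (c * (μ ^ 2 * L * n)
      + c ^ 2 * (2 * M * σ ^ 2 + μ ^ 2 * L ^ 2 / 2 * M ^ 3))) :
    1 / N * S ≤ 5 * L * M * D ^ 2 / N + 2 * σ * √M / √N * (Dt + D ^ 2 / Dt) := by
  have hN0 : 0 < N := by linarith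
  have hM0 : 0 < M := by linarith
  have hr : √N / N = 1 / √N := by rw [Real.sqrt_div_self']
  have hMn : c * (μ ^ 2 * L * n) ≤ c * (μ ^ 2 * L * M ^ 2) := by
    gcongr
    nlinarith
  have e1 : c * S ≤ 2 * (c - 2 * L * M * c ^ 2) * S := by
    apply mul_le_mul_of_nonneg_right _ hS
    nlinarith
  have e2 : 1 / N * S = 1 / (N * c) * (c * S) := by field_simp
  have e3 : 1 / (N * c) * (D ^ 2 + N * (c * (μ ^ 2 * L * M ^ 2)
      + c ^ 2 * (2 * M * σ ^ 2 + μ ^ 2 * L ^ 2 / 2 * M ^ 3)))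
      = D ^ 2 / N * (1 / c) + 2 * (σ ^ 2 * M * c) + μ ^ 2 * (M ^ 2 * (2 * N)) * (L / (2 * N))
        + μ ^ 2 * (M ^ 2 * (2 * N)) * (4 * L * M * c) * (L / (16 * N)) := by
    field_simp; ring
  have e4 : D ^ 2 / N * (1 / c) ≤ 4 * L * M * D ^ 2 / N + σ * √M / √N * (D ^ 2 / Dt) := by
    calc D ^ 2 / N * (1 / c) ≤ D ^ 2 / N * (4 * L * M + σ * √M * √N / Dt) := by gcongr
      _ = 4 * L * M * D ^ 2 / N + σ * √M * (√N / N) * (D ^ 2 / Dt) := by field_simp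
      _ = _ := by rw [hr]; ring
  have e5 : μ ^ 2 * (M ^ 2 * (2 * N)) * (L / (2 * N)) ≤ D ^ 2 * (L / (2 * N)) := by gcongr
  have e6 : μ ^ 2 * (M ^ 2 * (2 * N)) * (4 * L * M * c) * (L / (16 * N))
      ≤ D ^ 2 * 1 * (L / (16 * N)) := by gcongr
  have e7 : D ^ 2 * (L / (2 * N)) + D ^ 2 * 1 * (L / (16 * N)) ≤ L * M * D ^ 2 / N := by
    have : D ^ 2 * (L / (2 * N)) + D ^ 2 * 1 * (L / (16 * N)) = 9 / 16 * (L * D ^ 2 / N) := by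
      field_simp; ring
    rw [this, show L * M * D ^ 2 / N = M * (L * D ^ 2 / N) by ring]
    gcongr
    linarith
  have e8 : 0 ≤ σ * √M / √N * (D ^ 2 / Dt) := by positivity
  calc 1 / N * S ≤ 1 / (N * c) * (D ^ 2 + N * (c * (μ ^ 2 * L * M ^ 2)
      + c ^ 2 * (2 * M * σ ^ 2 + μ ^ 2 * L ^ 2 / 2 * M ^ 3))) := by
        rw [e2]
        gcongr
        refine (e1.trans hsum).trans ?_
        gcongr
    _ ≤ 4 * L * M * D ^ 2 / N + σ * √M / √N * (D ^ 2 / Dt) + 2 * (σ * √M / √N * Dt)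
        + L * M * D ^ 2 / N + σ * √M / √N * (D ^ 2 / Dt) := by rw [e3]; linarith
    _ = _ := by ring

/-- Both rates have the form `pt² + qt` with `t = √(n+4)/√N`; since `ε ≤ 1 ≤ K`, the quadratic term
is also of order `ε`. -/
theorem mul_sq_add_mul_le_of_le_div {p q t ε K : ℝ} (hp : 0 ≤ p) (hq : 0 ≤ q) (ht : 0 ≤ t)
    (hε : 0 < ε) (hε1 : ε ≤ 1) (hK : 1 ≤ K) (htK : t ≤ 3 * ε / K) (hpq : 9 * p + 3 * q ≤ K) :
    p * t ^ 2 + q * t ≤ ε := by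
  have hK0 : 0 < K := by linarith
  have h1 : t ^ 2 ≤ 9 * ε / K := by
    calc t ^ 2 ≤ (3 * ε / K) ^ 2 := by gcongr
      _ = 9 * ε / K * (ε / K) := by ring
      _ ≤ 9 * ε / K * 1 := by
        gcongr
        rw [div_le_one hK0]; linarith
      _ = _ := mul_one _
  calc p * t ^ 2 + q * t ≤ p * (9 * ε / K) + q * (3 * ε / K) := by gcongr
    _ = ε * ((9 * p + 3 * q) / K) := by ring
    _ ≤ ε * 1 := by
      gcongr
      rwa [div_le_one hK0]
    _ = ε := mul_one _

/-! ### Comparison of `D_f` and `D_X` -/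

section Objective

variable {n : ℕ} {f : E n → ℝ} {L : ℝ}

theorem sq_distF (hL : 0 < L) (hb : BddBelow (Set.range f)) (x₁ : E n) :
    distF L f x₁ ^ 2 = 2 * (f x₁ - optValue f) / L := by
  have h1 : optValue f ≤ f x₁ := ciInf_le hb x₁
  exact Real.sq_sqrt (div_nonneg (by linarith) hL.le)

theorem optValue_eq_of_isMinOn {y : E n} (hy : IsMinOn f Set.univ y) : optValue f = f y :=
  le_antisymm (ciInf_le ⟨f y, by rintro _ ⟨x, rfl⟩; exact isMinOn_univ_iff.1 hy x⟩ y)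
    (le_ciInf (isMinOn_univ_iff.1 hy))

/-- The Taylor bound at a minimizer has no linear term. Hence the smoothing bound in terms of `D_f`
also serves the estimate in terms of `D_X`. -/
theorem sq_distF_le (hL : 0 < L) (hf : IsC11 L f) {y : E n} (hy : IsMinOn f Set.univ y) (x₁ : E n) :
    distF L f x₁ ^ 2 ≤ ‖x₁ - y‖ ^ 2 := by
  rw [sq_distF hL ⟨f y, by rintro _ ⟨x, rfl⟩; exact isMinOn_univ_iff.1 hy x⟩,
    optValue_eq_of_isMinOn hy, div_le_iff₀ hL]
  have h1 := (abs_le.1 (hf.abs_sub_sub_inner_le y (x₁ - y))).2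
  rw [IsC11.gradient_eq_zero_of_isMinOn hy, inner_zero_left, add_sub_cancel] at h1
  linarith

end Objective

/-! ### The two rates -/

namespace IsRSGFRun

variable {n : ℕ} {Ω : Type u} {Ξ : Type v} [MeasurableSpace Ω] [MeasurableSpace Ξ]
  {Pr : Measure Ω} {P : Measure Ξ} {F : E n → Ξ → ℝ} {ξ : ℕ → Ω → Ξ} {w : ℕ → Ω → E n} {R : Ω → ℕ} {L σ Dt : ℝ} {γ : ℕ → ℝ}
  {μ : ℝ} {N : ℕ} {x₁ : E n}

theorem sq_smoothing_mul_le (h : IsRSGFRun Pr P F ξ w R L σ Dt γ μ N) (hN : 1 ≤ N)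
    (hμ : μ ≤ distF L (objective P F) x₁ / ((n + 4) * √(2 * N))) :
    μ ^ 2 * (((n : ℝ) + 4) ^ 2 * (2 * N)) ≤ distF L (objective P F) x₁ ^ 2 := by
  have hN' : (0 : ℝ) < N := by exact_mod_cast hN
  rw [le_div_iff₀ (by positivity)] at hμ
  have h1 := pow_le_pow_left₀ (mul_nonneg h.mu_pos.le (by positivity)) hμ 2
  rw [mul_pow, mul_pow, Real.sq_sqrt (by positivity)] at h1
  exact h1

variable [IsProbabilityMeasure Pr] [IsProbabilityMeasure P]

theorem integral_sq_norm_gradient_output_le (h : IsRSGFRun Pr P F ξ w R L σ Dt γ μ N)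
    (hL : 0 < L) (hσ : 0 ≤ σ) (hDt : 0 < Dt) (hN : 1 ≤ N)
    (hμ : μ ≤ distF L (objective P F) x₁ / ((n + 4) * √(2 * N))) :
    Integrable (fun ω => ‖gradient (objective P F) (rsgfOutput F γ μ x₁ ξ w R ω)‖ ^ 2) Pr ∧
      1 / L * ∫ ω, ‖gradient (objective P F) (rsgfOutput F γ μ x₁ ξ w R ω)‖ ^ 2 ∂Pr
        ≤ 12 * (n + 4) * L * distF L (objective P F) x₁ ^ 2 / N
          + 4 * σ * √(n + 4) / √N * (Dt + distF L (objective P F) x₁ ^ 2 / Dt) := by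
  set f := objective P F with hf
  have hC := h.program.isC11_objective
  have hcall : ∀ k ∈ Icc 1 N, IsOracleCall (historySigma ξ w k) Pr F f L σ (ξ k) (w k)
      (rsgfIterate F γ μ x₁ ξ w k) := fun k hk => by
    obtain ⟨j, rfl⟩ := Nat.exists_eq_add_of_le' (Finset.mem_Icc.1 hk).1
    exact h.isOracleCall hL.le x₁ j
  have hc := rsgfStep_pos (n := n) hL hσ hDt hN
  obtain ⟨i1, e1⟩ := integral_comp_uniform_index (φ := fun x => ‖gradient f x‖ ^ 2)
    h.sampling.measurable_count hN
    (fun k hk => (h.sampling.pmf k hk).trans (rsgfPmf_eq hL hσ hDt hN h.step hk))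
    (fun k hk => h.indepFun_count_iterate x₁ hk) (hC.continuous_gradient.norm.pow 2).measurable
    (fun k hk => (hcall k hk).integrable_sq_norm_gradient)
  refine ⟨i1, ?_⟩
  refine le_trans (le_of_eq (congrArg (1 / L * ·) e1)) ?_
  have hsum := mul_sum_Icc_le_of_step (a := fun k => ∫ ω, f (rsgfIterate F γ μ x₁ ξ w k ω) ∂Pr)
    (b := fun k => ∫ ω, ‖gradient f (rsgfIterate F γ μ x₁ ξ w k ω)‖ ^ 2 ∂Pr)
    (α := rsgfStep n L σ Dt N / 2 - L * (n + 4) * rsgfStep n L σ Dt N ^ 2)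
    (e := rsgfStep n L σ Dt N * (μ ^ 2 * L ^ 2 / 8 * (n + 4) ^ 2)
      + L * rsgfStep n L σ Dt N ^ 2 / 2
        * (2 * (n + 4) * σ ^ 2 + μ ^ 2 * L ^ 2 / 2 * (n + 4) ^ 3)) N (fun k hk => by
      obtain ⟨j, rfl⟩ := Nat.exists_eq_add_of_le' (Finset.mem_Icc.1 hk).1
      have h1 := (hcall _ hk).integral_objective_update_le h.mu_pos (γ := γ (j + 1))
        (by rw [h.step _ hk]; exact hc.le)
      rw [h.step _ hk] at h1
      simp only [rsgfIterate]
      rw [h.step _ hk]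
      exact h1)
  have hopt : ∀ x, optValue f ≤ f x := fun x => ciInf_le h.program.bddBelow x
  have hlast : optValue f ≤ ∫ ω, f (rsgfIterate F γ μ x₁ ξ w (N + 1) ω) ∂Pr := by
    have h2 := integral_mono (μ := Pr) (integrable_const (optValue f))
      (hC.integrable_comp (h.memLp_iterate hL.le x₁ N)) (fun ω => hopt _)
    simpa using h2
  have hfirst : ∫ ω, f (rsgfIterate F γ μ x₁ ξ w 1 ω) ∂Pr = f x₁ := by simp [rsgfIterate]
  have hD := sq_distF hL h.program.bddBelow x₁
  rw [← hf] at hD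
  refine gradient_rate_of_sum_le hL hσ hDt hc (by linarith [(Nat.cast_nonneg n : (0 : ℝ) ≤ n)])
    (by exact_mod_cast hN) (Finset.sum_nonneg fun k _ => integral_nonneg fun ω => by positivity)
    (rsgfStep_mul_le hL) (sq_mul_rsgfStep_le hσ hN) (one_div_rsgfStep_le hL hσ hDt hN)
    (h.sq_smoothing_mul_le hN hμ) ?_
  have hD' : L * distF L f x₁ ^ 2 / 2 = f x₁ - optValue f := by
    rw [hD]; field_simp
  rw [hD']
  simp only [hfirst] at hsum
  linarith

theorem integral_objective_output_le (h : IsRSGFRun Pr P F ξ w R L σ Dt γ μ N)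
    (hL : 0 < L) (hσ : 0 ≤ σ) (hDt : 0 < Dt) (hN : 1 ≤ N)
    (hμ : μ ≤ distF L (objective P F) x₁ / ((n + 4) * √(2 * N))) {y : E n}
    (hconv : ConvexOn ℝ Set.univ (objective P F)) (hy : IsMinOn (objective P F) Set.univ y) :
    Integrable (fun ω => objective P F (rsgfOutput F γ μ x₁ ξ w R ω)
        - optValue (objective P F)) Pr ∧
      ∫ ω, (objective P F (rsgfOutput F γ μ x₁ ξ w R ω) - optValue (objective P F)) ∂Pr
        ≤ 5 * L * (n + 4) * ‖x₁ - y‖ ^ 2 / N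
          + 2 * σ * √(n + 4) / √N * (Dt + ‖x₁ - y‖ ^ 2 / Dt) := by
  rw [optValue_eq_of_isMinOn hy]
  set f := objective P F with hf
  have hC := h.program.isC11_objective
  have hcall : ∀ k ∈ Icc 1 N, IsOracleCall (historySigma ξ w k) Pr F f L σ (ξ k) (w k)
      (rsgfIterate F γ μ x₁ ξ w k) := fun k hk => by
    obtain ⟨j, rfl⟩ := Nat.exists_eq_add_of_le' (Finset.mem_Icc.1 hk).1
    exact h.isOracleCall hL.le x₁ j
  have hc := rsgfStep_pos (n := n) hL hσ hDt hN
  obtain ⟨i1, e1⟩ := integral_comp_uniform_index (φ := fun x => f x - f y)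
    h.sampling.measurable_count hN
    (fun k hk => (h.sampling.pmf k hk).trans (rsgfPmf_eq hL hσ hDt hN h.step hk))
    (fun k hk => h.indepFun_count_iterate x₁ hk) (hC.continuous.sub continuous_const).measurable
    (fun k hk => (hC.integrable_comp (hcall k hk).memLp_point).sub (integrable_const _))
  refine ⟨i1, ?_⟩
  refine le_trans (le_of_eq e1) ?_
  have hsum := mul_sum_Icc_le_of_step
    (a := fun k => ∫ ω, ‖rsgfIterate F γ μ x₁ ξ w k ω - y‖ ^ 2 ∂Pr)
    (b := fun k => ∫ ω, (f (rsgfIterate F γ μ x₁ ξ w k ω) - f y) ∂Pr)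
    (α := 2 * (rsgfStep n L σ Dt N - 2 * L * (n + 4) * rsgfStep n L σ Dt N ^ 2))
    (e := rsgfStep n L σ Dt N * (μ ^ 2 * L * n) + rsgfStep n L σ Dt N ^ 2
        * (2 * (n + 4) * σ ^ 2 + μ ^ 2 * L ^ 2 / 2 * (n + 4) ^ 3)) N (fun k hk => by
      obtain ⟨j, rfl⟩ := Nat.exists_eq_add_of_le' (Finset.mem_Icc.1 hk).1
      have h1 := (hcall _ hk).integral_sq_dist_update_le hL h.mu_pos (γ := γ (j + 1))
        (by rw [h.step _ hk]; exact hc.le) hconv hy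
      rw [h.step _ hk] at h1
      simp only [rsgfIterate]
      rw [h.step _ hk]
      exact h1)
  have hlast : 0 ≤ ∫ ω, ‖rsgfIterate F γ μ x₁ ξ w (N + 1) ω - y‖ ^ 2 ∂Pr :=
    integral_nonneg fun ω => by positivity
  have hfirst : ∫ ω, ‖rsgfIterate F γ μ x₁ ξ w 1 ω - y‖ ^ 2 ∂Pr = ‖x₁ - y‖ ^ 2 := by
    simp [rsgfIterate]
  refine objective_rate_of_sum_le (n := n) hL hσ hDt hc (by linarith [(Nat.cast_nonneg n : (0 : ℝ) ≤ n)])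
    (by linarith) (by exact_mod_cast hN) (Finset.sum_nonneg fun k _ => integral_nonneg fun ω =>
      sub_nonneg.2 (isMinOn_univ_iff.1 hy _))
    (rsgfStep_mul_le hL) (sq_mul_rsgfStep_le hσ hN) (one_div_rsgfStep_le hL hσ hDt hN)
    ((h.sq_smoothing_mul_le hN hμ).trans (sq_distF_le hL hC hy x₁)) ?_
  simp only [hfirst] at hsum
  linarith

end IsRSGFRun

/-! ### Iteration complexity -/

theorem sqrt_div_sqrt_le_of_mul_div_sq_le {n N : ℕ} {K ε : ℝ} (hn : 1 ≤ n) (hε : 0 < ε)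
    (hK : 1 ≤ K) (h : K ^ 2 * (n / ε ^ 2) ≤ N) :
    1 ≤ N ∧ √(n + 4 : ℝ) / √N ≤ 3 * ε / K := by
  have hn' : (1 : ℝ) ≤ n := by exact_mod_cast hn
  have hK0 : 0 < K := by linarith
  have hN : (0 : ℝ) < N := lt_of_lt_of_le (by positivity) h
  refine ⟨by exact_mod_cast hN, ?_⟩
  rw [← Real.sqrt_div (by positivity)]
  refine Real.sqrt_le_iff.2 ⟨by positivity, ?_⟩
  rw [div_le_iff₀ hN]
  -- The crude factor `9` is a perfect square, which explains the `3` in the bound.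
  calc (n : ℝ) + 4 ≤ 9 * n := by linarith
    _ = (3 * ε / K) ^ 2 * (K ^ 2 * (n / ε ^ 2)) := by field_simp; norm_num
    _ ≤ _ := by gcongr

theorem mainTheorem6 (L σ Dt : ℝ) (hL : 0 < L) (hσ : 0 ≤ σ) (hDt : 0 < Dt) :
    -- the two bounds
    (∀ (n : ℕ) (Ω : Type u) (Ξ : Type v) [MeasurableSpace Ω] [MeasurableSpace Ξ]
        [StandardBorelSpace Ξ] (Pr : Measure Ω) [IsProbabilityMeasure Pr] (P : Measure Ξ)
        [IsProbabilityMeasure P] (F : E n → Ξ → ℝ) (ξ : ℕ → Ω → Ξ) (w : ℕ → Ω → E n)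
        (R : Ω → ℕ) (γ : ℕ → ℝ) (μ : ℝ) (N : ℕ) (x₁ : E n),
        1 ≤ N → IsRSGFRun Pr P F ξ w R L σ Dt γ μ N →
        μ ≤ distF L (objective P F) x₁ / ((n + 4) * √(2 * N)) →
        (Integrable (fun ω => ‖gradient (objective P F) (rsgfOutput F γ μ x₁ ξ w R ω)‖ ^ 2) Pr ∧
          1 / L * ∫ ω, ‖gradient (objective P F) (rsgfOutput F γ μ x₁ ξ w R ω)‖ ^ 2 ∂Pr
            ≤ 12 * (n + 4) * L * distF L (objective P F) x₁ ^ 2 / N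
              + 4 * σ * √(n + 4) / √N * (Dt + distF L (objective P F) x₁ ^ 2 / Dt)) ∧
        (∀ xstar : E n, ConvexOn ℝ Set.univ (objective P F) →
          IsMinOn (objective P F) Set.univ xstar →
          μ ≤ ‖x₁ - xstar‖ / √(n + 4) →
          Integrable (fun ω => objective P F (rsgfOutput F γ μ x₁ ξ w R ω)
              - optValue (objective P F)) Pr ∧
            ∫ ω, (objective P F (rsgfOutput F γ μ x₁ ξ w R ω) - optValue (objective P F)) ∂Pr
              ≤ 5 * L * (n + 4) * ‖x₁ - xstar‖ ^ 2 / N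
                + 2 * σ * √(n + 4) / √N * (Dt + ‖x₁ - xstar‖ ^ 2 / Dt))) ∧
    -- `O(n / ε²)` iterations give an `ε`-solution; the constant depends on `L`, `σ`, `Dt` and an
    -- upper bound `D` of `D_f`, respectively `D_X`, only
    (∀ D : ℝ, ∃ C : ℝ, 0 < C ∧
      ∀ (n : ℕ) (Ω : Type u) (Ξ : Type v) [MeasurableSpace Ω] [MeasurableSpace Ξ]
        [StandardBorelSpace Ξ] (Pr : Measure Ω) [IsProbabilityMeasure Pr] (P : Measure Ξ)
        [IsProbabilityMeasure P] (F : E n → Ξ → ℝ) (ξ : ℕ → Ω → Ξ) (w : ℕ → Ω → E n)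
        (R : Ω → ℕ) (γ : ℕ → ℝ) (μ : ℝ) (N : ℕ) (x₁ : E n) (ε : ℝ),
        1 ≤ n → 0 < ε → ε ≤ 1 → C * (n / ε ^ 2) ≤ N →
        IsRSGFRun Pr P F ξ w R L σ Dt γ μ N →
        μ ≤ distF L (objective P F) x₁ / ((n + 4) * √(2 * N)) →
        (distF L (objective P F) x₁ ≤ D →
          ∫ ω, ‖gradient (objective P F) (rsgfOutput F γ μ x₁ ξ w R ω)‖ ^ 2 ∂Pr ≤ ε) ∧
        (∀ xstar : E n, ConvexOn ℝ Set.univ (objective P F) →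
          IsMinOn (objective P F) Set.univ xstar →
          μ ≤ ‖x₁ - xstar‖ / √(n + 4) → ‖x₁ - xstar‖ ≤ D →
          ∫ ω, (objective P F (rsgfOutput F γ μ x₁ ξ w R ω) - optValue (objective P F)) ∂Pr
            ≤ ε)) := by
  refine ⟨fun n Ω Ξ _ _ _ Pr _ P _ F ξ w R γ μ N x₁ hN hrun hμ =>
    ⟨hrun.integral_sq_norm_gradient_output_le hL hσ hDt hN hμ, fun xstar hconv hmin _ =>
      hrun.integral_objective_output_le hL hσ hDt hN hμ hconv hmin⟩, fun D => ?_⟩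
  set T := Dt + D ^ 2 / Dt with hT
  have hT0 : 0 < T := by positivity
  -- `K` dominates `9p + 3q` for both pairs `(p, q)`: `(12L²D², 4LσT)` for the gradient, after
  -- multiplication by `L`, and `(5LD², 2σT)` for the objective. The complexity constant is `K²`.
  set K := 1 + 9 * (12 * L ^ 2 * D ^ 2 + 5 * L * D ^ 2) + 3 * (4 * L * σ * T + 2 * σ * T) with hKdef
  have a1 : 0 ≤ L ^ 2 * D ^ 2 := by positivity
  have a2 : 0 ≤ L * D ^ 2 := by positivity
  have a3 : 0 ≤ L * σ * T := by positivity
  have a4 : 0 ≤ σ * T := by positivity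
  have hK : 1 ≤ K := by linarith
  refine ⟨K ^ 2, by positivity, ?_⟩
  intro n Ω Ξ _ _ _ Pr _ P _ F ξ w R γ μ N x₁ ε hn hε hε1 hNC hrun hμ
  obtain ⟨hN, ht⟩ := sqrt_div_sqrt_le_of_mul_div_sq_le hn hε hK hNC
  have ht0 : 0 ≤ √(n + 4 : ℝ) / √N := by positivity
  have htsq : (√(n + 4 : ℝ) / √N) ^ 2 = (n + 4) / N := by
    rw [div_pow, Real.sq_sqrt (by positivity), Real.sq_sqrt (by positivity)]
  refine ⟨fun hD => ?_, fun xstar hconv hmin _ hD => ?_⟩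
  · have h1 := (hrun.integral_sq_norm_gradient_output_le hL hσ hDt hN hμ).2
    rw [one_div_mul_eq_div, div_le_iff₀ hL] at h1
    have h2 : distF L (objective P F) x₁ ^ 2 ≤ D ^ 2 := pow_le_pow_left₀ (Real.sqrt_nonneg _) hD 2
    refine h1.trans ?_
    calc _ ≤ (12 * (n + 4) * L * D ^ 2 / N + 4 * σ * √(n + 4) / √N * T) * L := by
          rw [hT]; gcongr
      _ = 12 * L ^ 2 * D ^ 2 * (√(n + 4 : ℝ) / √N) ^ 2
          + 4 * L * σ * T * (√(n + 4 : ℝ) / √N) := by rw [htsq]; ring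
      _ ≤ ε := mul_sq_add_mul_le_of_le_div (by positivity) (by positivity) ht0 hε hε1 hK ht
          (by linarith)
  · have h1 := (hrun.integral_objective_output_le hL hσ hDt hN hμ hconv hmin).2
    have h2 : ‖x₁ - xstar‖ ^ 2 ≤ D ^ 2 := pow_le_pow_left₀ (norm_nonneg _) hD 2
    refine h1.trans ?_
    calc _ ≤ 5 * L * (n + 4) * D ^ 2 / N + 2 * σ * √(n + 4) / √N * T := by
          rw [hT]; gcongr
      _ = 5 * L * D ^ 2 * (√(n + 4 : ℝ) / √N) ^ 2
          + 2 * σ * T * (√(n + 4 : ℝ) / √N) := by rw [htsq]; ring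
      _ ≤ ε := mul_sq_add_mul_le_of_le_div (by positivity) (by positivity) ht0 hε hε1 hK ht
          (by linarith)
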